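/- **Theorem 4.4.** Let $E_8$ denote the $E_8$ root lattice, let $O(E_8)$ be its isometry group, and call $h\in O(E_8)$ *rootless* if $(h-1)E_8$ contains no root, i.e. no vector of norm $2$. Let $A_2=\{x\in\mathbb Z^3 : x_1+x_2+x_3=0\}$ with the standard dot product, and let $h_{A_2}$ be the isometry of $A_2$ that permutes the coordinates by a $3$-cycle. Let $h\in O(E_8)$ have order $3$ and let $F=\{x\in E_8 : hx=x\}$ be its fixed-point sublattice. Then: 1. $h$ is rootless if and only if $F=0$ or $F\cong A_2$ (isometry of lattices). 2. $E_8$ contains a sublattice isometric to the orthogonal sum $A_2^4=A_2\perp A_2\perp A_2\perp A_2$. For every identification of $A_2^4$ with a sublattice of $E_8$ and either choice of the $3$-cycle, the isometries $h_{A_2}^{\oplus 4}$ and $h_{A_2}^{\oplus 3}\oplus \mathrm{id}_{A_2}$ of $A_2^4$ extend uniquely to isometries of $E_8$; denote the extensions by the same symbols. Then $h$ is conjugate in $O(E_8)$ to $h_{A_2}^{\oplus 4}$ if $F=0$, and $h$ is conjugate in $O(E_8)$ to $h_{A_2}^{\oplus 3}\oplus \mathrm{id}_{A_2}$ if $F\cong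 A_2$. -/

import Mathlib

namespace RootlessE8

open LinearMap (BilinForm)

/-- An isometric embedding of lattices: an injective additive map that preserves the forms. -/
structure IsIsometricEmbedding {M N : Type*} [AddCommGroup M] [AddCommGroup N]
    (B : BilinForm ℤ M) (C : BilinForm ℤ N) (f : M →ₗ[ℤ] N) : Prop where
  injective : Function.Injective f
  map_form : ∀ x y, C (f x) (f y) = B x y

/-- Two lattices are isometric. -/
def Isometric {M N : Type*} [AddCommGroup M] [AddCommGroup N]
    (B : BilinForm ℤ M) (C : BilinForm ℤ N) : Prop :=
  ∃ e : M ≃ₗ[ℤ] N, ∀ x y, C (e x) (e y) = B x y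

/-- The isometry group `O(M)` of a lattice `M` with bilinear form `B`. -/
def isometryGroup {M : Type*} [AddCommGroup M] (B : BilinForm ℤ M) : Subgroup (M ≃ₗ[ℤ] M) where
  carrier := {g | ∀ x y, B (g x) (g y) = B x y}
  one_mem' := fun _ _ => rfl
  mul_mem' := by
    intro a b ha hb x y
    rw [LinearEquiv.mul_apply, LinearEquiv.mul_apply, ha, hb]
  inv_mem' := by
    intro a ha x y
    have key := ha (a⁻¹ x) (a⁻¹ y)
    rw [← LinearEquiv.mul_apply, ← LinearEquiv.mul_apply, mul_inv_cancel] at key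
    exact key.symm

/-- The fixed-point sublattice of `h`. -/
def fixedLattice {M : Type*} [AddCommGroup M] (h : M ≃ₗ[ℤ] M) : Submodule ℤ M :=
  LinearMap.ker ((h : M →ₗ[ℤ] M) - LinearMap.id)

/-- `h` is rootless if `(h - 1)M` contains no root, that is, no vector of norm `2`. -/
def IsRootless {M : Type*} [AddCommGroup M] (B : BilinForm ℤ M) (h : M ≃ₗ[ℤ] M) : Prop :=
  ∀ v ∈ LinearMap.range ((h : M →ₗ[ℤ] M) - LinearMap.id), B v v ≠ 2

/-- The `E₈` lattice: `ℤ⁸` with the form whose Gram matrix is the Cartan matrix of type `E₈`. -/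
abbrev E8 : Type := Fin 8 → ℤ

/-- The bilinear form of the `E₈` lattice. -/
def formE8 : BilinForm ℤ E8 := Matrix.toBilin' CartanMatrix.E₈

/-- The `Aₙ` lattice: the vectors of coordinate sum zero in `ℤⁿ⁺¹`. -/
def latticeA (n : ℕ) : Submodule ℤ (Fin (n + 1) → ℤ) :=
  LinearMap.ker (∑ i, LinearMap.proj i : (Fin (n + 1) → ℤ) →ₗ[ℤ] ℤ)

/-- The bilinear form of `Aₙ`: the restriction of the standard dot product. -/
def formA (n : ℕ) : BilinForm ℤ (latticeA n) :=
  (Matrix.toBilin' (1 : Matrix (Fin (n + 1)) (Fin (n + 1)) ℤ)).restrict (latticeA n)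

/-- The action of the symmetric group (the Weyl group) on `Aₙ` by permuting the coordinates. -/
def permA (n : ℕ) (σ : Equiv.Perm (Fin (n + 1))) : latticeA n →ₗ[ℤ] latticeA n :=
  (LinearMap.funLeft ℤ ℤ (σ⁻¹ : Equiv.Perm (Fin (n + 1)))).restrict (by
    intro x hx
    simp only [latticeA, LinearMap.mem_ker, LinearMap.sum_apply, LinearMap.proj_apply,
      LinearMap.funLeft_apply] at hx ⊢
    rw [← hx]
    exact Equiv.sum_comp (σ⁻¹) x)

/-- The form on the orthogonal direct sum of `m` copies of a lattice. -/
def formPow {M : Type*} [AddCommGroup M] (B : BilinForm ℤ M) (m : ℕ) :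
    BilinForm ℤ (Fin m → M) :=
  ∑ i, B.compl₁₂ (LinearMap.proj i) (LinearMap.proj i)

/-- The underlying group of `A₂ ⊥ A₂ ⊥ A₂ ⊥ A₂`. -/
abbrev A2pow4 : Type := Fin 4 → latticeA 2

/-- The isometry of `A₂⁴` that permutes the coordinates of each of the first `k` summands by `σ`
and is the identity on the other summands. -/
def blockPerm (σ : Equiv.Perm (Fin 3)) (k : ℕ) : A2pow4 →ₗ[ℤ] A2pow4 :=
  LinearMap.pi fun i =>
    (if (i : ℕ) < k then permA 2 σ else LinearMap.id).comp (LinearMap.proj i)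

/-- The isometry `g` of `E₈` restricts to `f` on the sublattice `A₂⁴` embedded by `φ`. -/
def Extends (φ : A2pow4 →ₗ[ℤ] E8) (f : A2pow4 →ₗ[ℤ] A2pow4) (g : isometryGroup formE8) : Prop :=
  ∀ v, g.1 (φ v) = φ (f v)

end RootlessE8

namespace RootlessE8

open LinearMap (BilinForm)

/-! The key fact is that the roots of $E_8$ form a spherical design: their second and fourth moments
are those of a rotation invariant measure. If $h^3=1$ and $t=\operatorname{tr} h$, summing over
positive roots gives $\sum (a,ha)=30t$ and $\sum (a,ha)^2=6(t^2+8+t)$. Moreover $t\equiv 8 \pmod 3$,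
because $h$ is unipotent modulo $3$. For a root $a$ the value $(a,ha)$ lies in $\{-1,0,1,2\}$. It is
$2$ only if $a$ is fixed, it is $-1$ only if $a+ha+h^2a=0$, and if it is $1$ then $ha-a$ is a root
with vanishing orbit sum. If no root had vanishing orbit sum, only $0$ and $2$ would occur, and the
moments would give $(t-1)(t-8)=0$, so $t=8$ and $h=1$ (`exists_root_orbit_sum_eq_zero`).

A root with vanishing orbit sum spans with its image an $A_2$ on which $h$ is a rotation. Dividing
$h$ by this rotation enlarges the fixed lattice, so by induction $h$ is a product of rotations in
$n\le 4$ orthogonal $A_2$-planes and is trivial on their complement (`exists_isFrame`).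

If $n$ is $1$ or $2$, unimodularity gives a vector whose projection is a minimal vector of $A_2^*$
in one plane and zero in the other; its displacement is a root. If $n=4$ then $F=0$. If $n=3$ and
$h$ is rootless, the moments count at least three fixed positive roots; they cannot all be
orthogonal in rank $2$, so $F$ contains an $A_2$, and an integrality argument shows $F$ is that
$A_2$. Conversely, if $hx-x$ is a root, then the orbit sum of $x$ lies in $F$ (indeed in $3F^*$) and
has norm $9(x,x)-6$, which is impossible for $F=0$ and for $F\cong A_2$.

For conjugacy, $E_8$ is recovered from an embedded $A_2^4$ by a self-orthogonal ternary code of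
length $4$, which is the tetracode up to signs (`exists_signMap_isTetracode`). Any two embeddings
thus differ by signs and an isometry of $E_8$. Coordinate permutations act trivially on $A_2^*/A_2$
and commute with signs, so they extend to $E_8$, and extensions along different embeddings are
conjugate. -/

/-! ### Positive roots and their second and fourth moments. -/

/-- The positive roots of `E₈`; the decimal digits are the coefficients of the simple roots. -/
def rootCodes : List ℕ :=
  [1, 10, 100, 1000, 10000, 100000, 1000000, 10000000, 11, 110, 1100, 11000, 110000, 1010000,
   10100000, 111, 1110, 11100, 111000, 1011000, 1110000, 10110000, 1111, 11110, 111100, 1011100,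
   1111000, 10111000, 11110000, 11111, 111110, 1011110, 1111100, 1121000, 10111100, 11111000,
   111111, 1011111, 1111110, 1121100, 10111110, 11111100, 11121000, 1111111, 1121110, 1122100,
   10111111, 11111110, 11121100, 11221000, 1121111, 1122110, 11111111, 11121110, 11122100,
   11221100, 1122111, 1122210, 11121111, 11122110, 11221110, 11222100, 1122211, 11122111,
   11122210, 11221111, 11222110, 11232100, 1122221, 11122211, 11222111, 11222210, 11232110,
   12232100, 11122221, 11222211, 11232111, 11232210, 12232110, 11222221, 11232211, 11233210,
   12232111, 12232210, 11232221, 11233211, 12232211, 12233210, 11233221, 12232221, 12233211,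
   12243210, 11233321, 12233221, 12243211, 12343210, 12233321, 12243221, 12343211, 22343210,
   12243321, 12343221, 22343211, 12244321, 12343321, 22343221, 12344321, 22343321, 12354321,
   22344321, 13354321, 22354321, 22454321, 23354321, 23454321, 23464321, 23465321, 23465421,
   23465431, 23465432]

/-- The coefficient of the `i`-th simple root in the root with code `c`. -/
def rootDigit (c : ℕ) (i : Fin 8) : ℕ := c / 10 ^ (7 - (i : ℕ)) % 10

/-- The inverse of the Gram matrix of `E₈`. -/
def gramInv : Matrix (Fin 8) (Fin 8) ℕ :=
  !![4, 5, 7, 10, 8, 6, 4, 2;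
     5, 8, 10, 15, 12, 9, 6, 3;
     7, 10, 14, 20, 16, 12, 8, 4;
     10, 15, 20, 30, 24, 18, 12, 6;
     8, 12, 16, 24, 20, 15, 10, 5;
     6, 9, 12, 18, 15, 12, 8, 4;
     4, 6, 8, 12, 10, 8, 6, 3;
     2, 3, 4, 6, 5, 4, 3, 2]

/-- The coefficients of a root are its products with the dual basis, whose Gram matrix is `gramInv`.
The constant is the Coxeter number $30$. -/
theorem rootCodes_design_two : ∀ i j : Fin 8,
    (rootCodes.map fun c => rootDigit c i * rootDigit c j).sum = 30 * gramInv i j := by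
  decide +kernel

theorem gramInv_transpose : gramInv.transpose = gramInv := by
  decide +kernel

theorem gramInv_comm (i j : Fin 8) : gramInv i j = gramInv j i :=
  congrFun (congrFun gramInv_transpose j) i

/-- This is the polarised identity $\sum (a,x)^4=18(x,x)^2$. The order on the indices leaves fewer
cases to evaluate; the symmetries of both sides supply the others. -/
theorem rootCodes_design_four_of_le : ∀ i j : Fin 8, i ≤ j → ∀ k, i ≤ k → ∀ l, k ≤ l →
    (rootCodes.map fun c => rootDigit c i * rootDigit c j * (rootDigit c k * rootDigit c l)).sum =
      6 * (gramInv i j * gramInv k l + gramInv i k * gramInv j l + gramInv i l * gramInv j k) := by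
  decide +kernel

theorem rootCodes_design_four (i j k l : Fin 8) :
    (rootCodes.map fun c => rootDigit c i * rootDigit c j * (rootDigit c k * rootDigit c l)).sum =
      6 * (gramInv i j * gramInv k l + gramInv i k * gramInv j l + gramInv i l * gramInv j k) := by
  wlog hij : i ≤ j generalizing i j
  · have := this j i (le_of_not_ge hij)
    simp only [mul_comm (rootDigit _ j) (rootDigit _ i)] at this
    rw [this, gramInv_comm j i]
    ring
  wlog hkl : k ≤ l generalizing k l
  · have := this l k (le_of_not_ge hkl)
    simp only [mul_comm (rootDigit _ l) (rootDigit _ k)] at this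
    rw [this, gramInv_comm l k]
    ring
  wlog hik : i ≤ k generalizing i j k l
  · have hki := le_of_not_ge hik
    have := this k l hkl i j hij hki
    simp only [mul_comm (rootDigit _ k * rootDigit _ l)] at this
    rw [this, gramInv_comm k i, gramInv_comm l j, gramInv_comm k j, gramInv_comm l i]
    ring
  exact rootCodes_design_four_of_le i j hij k hik l hkl

/-- The root with code `c`. -/
def rootOfCode (c : ℕ) : E8 := fun i => (rootDigit c i : ℤ)

/-- The set of positive roots of `E₈`. -/
def posRoots : Finset E8 := (rootCodes.map rootOfCode).toFinset

theorem nodup_rootCodes_map : (rootCodes.map rootOfCode).Nodup := by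
  decide +kernel

theorem sum_posRoots (f : E8 → ℤ) :
    ∑ a ∈ posRoots, f a = (rootCodes.map fun c => f (rootOfCode c)).sum := by
  rw [posRoots, List.sum_toFinset _ nodup_rootCodes_map, List.map_map]
  rfl

theorem sum_posRoots_two (i j : Fin 8) :
    ∑ a ∈ posRoots, a i * a j = 30 * (gramInv i j : ℤ) := by
  rw [sum_posRoots]
  have h := congrArg (Nat.cast : ℕ → ℤ) (rootCodes_design_two i j)
  rw [Nat.cast_list_sum, List.map_map] at h
  push_cast at h
  rw [← h]
  congr 1

theorem sum_posRoots_four (i j k l : Fin 8) :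
    ∑ a ∈ posRoots, a i * a j * (a k * a l) =
      6 * ((gramInv i j : ℤ) * gramInv k l + gramInv i k * gramInv j l
        + gramInv i l * gramInv j k) := by
  rw [sum_posRoots]
  have h := congrArg (Nat.cast : ℕ → ℤ) (rootCodes_design_four i j k l)
  rw [Nat.cast_list_sum, List.map_map] at h
  push_cast at h
  rw [← h]
  congr 1

theorem card_posRoots : posRoots.card = 120 := by
  rw [posRoots, List.toFinset_card_of_nodup nodup_rootCodes_map]
  rfl

/-! ### The form: even, positive definite and unimodular. -/

theorem formE8_apply (x y : E8) : formE8 x y = x ⬝ᵥ CartanMatrix.E₈.mulVec y := by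
  rw [formE8, Matrix.toBilin'_apply']

theorem formE8_rootOfCode_self : ∀ c ∈ rootCodes,
    rootOfCode c ⬝ᵥ CartanMatrix.E₈.mulVec (rootOfCode c) = 2 := by
  decide +kernel

theorem formE8_posRoots_self {a : E8} (ha : a ∈ posRoots) : formE8 a a = 2 := by
  simp only [posRoots, List.mem_toFinset, List.mem_map] at ha
  obtain ⟨c, hc, rfl⟩ := ha
  rw [formE8_apply]
  exact formE8_rootOfCode_self c hc

theorem posRoots_nonneg {a : E8} (ha : a ∈ posRoots) (i : Fin 8) : 0 ≤ a i := by
  simp only [posRoots, List.mem_toFinset, List.mem_map] at ha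
  obtain ⟨c, hc, rfl⟩ := ha
  exact Int.natCast_nonneg _

theorem single_mem_posRoots (i : Fin 8) : Pi.single i 1 ∈ posRoots := by
  rw [posRoots, List.mem_toFinset]
  revert i
  decide +kernel

theorem formE8_comm (x y : E8) : formE8 x y = formE8 y x := by
  simp only [formE8_apply, CartanMatrix.E₈, Matrix.mulVec, dotProduct, Fin.sum_univ_eight]
  simp [Matrix.of_apply]
  ring

theorem even_formE8_self (x : E8) : Even (formE8 x x) := by
  refine ⟨x 0 ^ 2 + x 1 ^ 2 + x 2 ^ 2 + x 3 ^ 2 + x 4 ^ 2 + x 5 ^ 2 + x 6 ^ 2 + x 7 ^ 2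
    - x 0 * x 2 - x 1 * x 3 - x 2 * x 3 - x 3 * x 4 - x 4 * x 5 - x 5 * x 6 - x 6 * x 7, ?_⟩
  simp only [formE8_apply, CartanMatrix.E₈, Matrix.mulVec, dotProduct, Fin.sum_univ_eight]
  simp [Matrix.of_apply]
  ring

/-- Completing squares in the order of the variables gives positive definiteness; the factor $60$
clears the denominators. -/
theorem formE8_self_sos (x : E8) : 60 * formE8 x x =
    30 * (2 * x 0 - x 2) ^ 2 + 30 * (2 * x 1 - x 3) ^ 2 + 10 * (3 * x 2 - 2 * x 3) ^ 2
      + 2 * (5 * x 3 - 6 * x 4) ^ 2 + 3 * (4 * x 4 - 5 * x 5) ^ 2 + 5 * (3 * x 5 - 4 * x 6) ^ 2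
      + 10 * (2 * x 6 - 3 * x 7) ^ 2 + 30 * x 7 ^ 2 := by
  simp only [formE8_apply, CartanMatrix.E₈, Matrix.mulVec, dotProduct, Fin.sum_univ_eight]
  simp [Matrix.of_apply]
  ring

theorem formE8_self_nonneg (x : E8) : 0 ≤ formE8 x x := by
  have h := formE8_self_sos x
  have : 0 ≤ 60 * formE8 x x := by rw [h]; positivity
  linarith

theorem formE8_self_eq_zero {x : E8} (hx : formE8 x x = 0) : x = 0 := by
  have h := formE8_self_sos x
  rw [hx] at h
  have key : ∀ y : ℤ, y ^ 2 ≤ 0 → y = 0 := fun y hy =>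
    pow_eq_zero_iff two_ne_zero |>.1 (le_antisymm hy (sq_nonneg y))
  have n0 := sq_nonneg (2 * x 0 - x 2)
  have n1 := sq_nonneg (2 * x 1 - x 3)
  have n2 := sq_nonneg (3 * x 2 - 2 * x 3)
  have n3 := sq_nonneg (5 * x 3 - 6 * x 4)
  have n4 := sq_nonneg (4 * x 4 - 5 * x 5)
  have n5 := sq_nonneg (3 * x 5 - 4 * x 6)
  have n6 := sq_nonneg (2 * x 6 - 3 * x 7)
  have n7 := sq_nonneg (x 7)
  have e7 := key (x 7) (by linarith)
  have e0 := key (2 * x 0 - x 2) (by linarith)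
  have e1 := key (2 * x 1 - x 3) (by linarith)
  have e2 := key (3 * x 2 - 2 * x 3) (by linarith)
  have e3 := key (5 * x 3 - 6 * x 4) (by linarith)
  have e4 := key (4 * x 4 - 5 * x 5) (by linarith)
  have e5 := key (3 * x 5 - 4 * x 6) (by linarith)
  have e6 := key (2 * x 6 - 3 * x 7) (by linarith)
  ext i
  clear h n0 n1 n2 n3 n4 n5 n6 n7
  fin_cases i <;> simp <;> omega

theorem formE8_self_pos {x : E8} (hx : x ≠ 0) : 0 < formE8 x x :=
  (formE8_self_nonneg x).lt_of_ne fun h => hx (formE8_self_eq_zero h.symm)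

theorem gramInv_mul : gramInv.map (Nat.cast : ℕ → ℤ) * CartanMatrix.E₈ = 1 := by
  decide +kernel

/-- `E₈` is unimodular: a vector whose products are all divisible by `n` is divisible by `n`. -/
theorem exists_smul_of_dvd_formE8 {n : ℤ} {c : E8} (h : ∀ x, n ∣ formE8 x c) :
    ∃ y, c = n • y := by
  have h1 : ∀ i, n ∣ CartanMatrix.E₈.mulVec c i := fun i => by
    simpa [formE8_apply] using h (Pi.single i 1)
  choose u hu using h1
  refine ⟨(gramInv.map (Nat.cast : ℕ → ℤ)).mulVec u, ?_⟩
  rw [← Matrix.mulVec_smul]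
  have : n • u = CartanMatrix.E₈.mulVec c := funext fun i => by simp [hu i]
  rw [this, Matrix.mulVec_mulVec, gramInv_mul, Matrix.one_mulVec]

/-- This is Cauchy–Schwarz with its equality case, read off from the norm of `x - y`. -/
theorem formE8_le_two {x y : E8} (hx : formE8 x x = 2) (hy : formE8 y y = 2) :
    formE8 x y ≤ 2 ∧ (formE8 x y = 2 → x = y) := by
  have h : formE8 (x - y) (x - y) = 4 - 2 * formE8 x y := by
    simp only [map_sub, LinearMap.sub_apply, hx, hy, formE8_comm y x]
    ring
  refine ⟨by linarith [formE8_self_nonneg (x - y)], fun h2 => ?_⟩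
  exact sub_eq_zero.1 (formE8_self_eq_zero (by rw [h, h2]; norm_num))

/-! ### Moments of the roots against bilinear forms. -/

/-- The second moment of the positive roots against a bilinear form. -/
theorem sum_posRoots_bilin (A : Matrix (Fin 8) (Fin 8) ℤ) :
    ∑ a ∈ posRoots, a ⬝ᵥ A.mulVec a =
      30 * (A * gramInv.map (Nat.cast : ℕ → ℤ)).trace := by
  have h : ∀ a : E8, a ⬝ᵥ A.mulVec a = ∑ i, ∑ j, A i j * (a i * a j) := fun a => by
    simp only [dotProduct, Matrix.mulVec, Finset.mul_sum]
    exact Finset.sum_congr rfl fun i _ => Finset.sum_congr rfl fun j _ => by ring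
  simp only [h]
  rw [Finset.sum_comm]
  simp only [Matrix.trace, Matrix.diag, Matrix.mul_apply, Finset.mul_sum, Matrix.map_apply]
  refine Finset.sum_congr rfl fun i _ => ?_
  rw [Finset.sum_comm]
  refine Finset.sum_congr rfl fun j _ => ?_
  rw [← Finset.mul_sum, sum_posRoots_two, gramInv_comm]
  ring

/-- The fourth moment of the positive roots against the square of a bilinear form. -/
theorem sum_posRoots_bilin_sq (A : Matrix (Fin 8) (Fin 8) ℤ)
    (Q : Matrix (Fin 8) (Fin 8) ℤ) (hQ : Q = gramInv.map (Nat.cast : ℕ → ℤ)) :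
    ∑ a ∈ posRoots, (a ⬝ᵥ A.mulVec a) ^ 2 =
      6 * ((A * Q).trace ^ 2 + (A * Q * (A.transpose * Q)).trace + (A * Q * (A * Q)).trace) := by
  have hQs : ∀ i j, Q i j = Q j i := fun i j => by simp [hQ, gramInv_comm i j]
  have h4 : ∀ i j k l, ∑ a ∈ posRoots, a i * a j * (a k * a l) =
      6 * (Q i j * Q k l + Q i k * Q j l + Q i l * Q j k) := fun i j k l => by
    rw [sum_posRoots_four, hQ]; rfl
  have h : ∀ a : E8, (a ⬝ᵥ A.mulVec a) ^ 2 =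
      ∑ i, ∑ j, ∑ k, ∑ l, A i j * A k l * (a i * a j * (a k * a l)) := fun a => by
    have h1 : a ⬝ᵥ A.mulVec a = ∑ i, ∑ j, A i j * (a i * a j) := by
      simp only [dotProduct, Matrix.mulVec, Finset.mul_sum]
      exact Finset.sum_congr rfl fun i _ => Finset.sum_congr rfl fun j _ => by ring
    rw [h1, sq, Finset.sum_mul]
    refine Finset.sum_congr rfl fun i _ => ?_
    rw [Finset.sum_mul]
    refine Finset.sum_congr rfl fun j _ => ?_
    rw [Finset.mul_sum]
    refine Finset.sum_congr rfl fun k _ => ?_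
    rw [Finset.mul_sum]
    exact Finset.sum_congr rfl fun l _ => by ring
  have e1 : (A * Q).trace ^ 2 = ∑ i, ∑ j, ∑ k, ∑ l, A i j * A k l * (Q i j * Q k l) := by
    have h1 : (A * Q).trace = ∑ i, ∑ j, A i j * Q i j := by
      simp only [Matrix.trace, Matrix.diag, Matrix.mul_apply]
      exact Finset.sum_congr rfl fun i _ => Finset.sum_congr rfl fun j _ => by rw [hQs j i]
    rw [h1, sq, Finset.sum_mul]
    refine Finset.sum_congr rfl fun i _ => ?_
    rw [Finset.sum_mul]
    refine Finset.sum_congr rfl fun j _ => ?_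
    rw [Finset.mul_sum]
    refine Finset.sum_congr rfl fun k _ => ?_
    rw [Finset.mul_sum]
    exact Finset.sum_congr rfl fun l _ => by ring
  have e2 : (A * Q * (A.transpose * Q)).trace =
      ∑ i, ∑ j, ∑ k, ∑ l, A i j * A k l * (Q i k * Q j l) := by
    simp only [Matrix.trace, Matrix.diag, Matrix.mul_apply, Matrix.transpose_apply,
      Finset.sum_mul, Finset.mul_sum]
    refine Finset.sum_congr rfl fun i _ => ?_
    trans ∑ l, ∑ k, ∑ j, A i j * Q j l * (A k l * Q k i)
    · rfl
    rw [Finset.sum_comm]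
    trans ∑ k, ∑ j, ∑ l, A i j * Q j l * (A k l * Q k i)
    · exact Finset.sum_congr rfl fun k _ => Finset.sum_comm
    rw [Finset.sum_comm]
    refine Finset.sum_congr rfl fun j _ => Finset.sum_congr rfl fun k _ =>
      Finset.sum_congr rfl fun l _ => ?_
    rw [hQs k i]; ring
  have e3 : (A * Q * (A * Q)).trace =
      ∑ i, ∑ j, ∑ k, ∑ l, A i j * A k l * (Q i l * Q j k) := by
    simp only [Matrix.trace, Matrix.diag, Matrix.mul_apply,
      Finset.sum_mul, Finset.mul_sum]
    refine Finset.sum_congr rfl fun i _ => ?_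
    trans ∑ k, ∑ l, ∑ j, A i j * Q j k * (A k l * Q l i)
    · rfl
    trans ∑ k, ∑ j, ∑ l, A i j * Q j k * (A k l * Q l i)
    · exact Finset.sum_congr rfl fun k _ => Finset.sum_comm
    rw [Finset.sum_comm]
    refine Finset.sum_congr rfl fun j _ => Finset.sum_congr rfl fun k _ =>
      Finset.sum_congr rfl fun l _ => ?_
    rw [hQs l i]; ring
  rw [e1, e2, e3]
  simp only [h]
  simp only [← Finset.sum_add_distrib, Finset.mul_sum]
  rw [Finset.sum_comm]
  refine Finset.sum_congr rfl fun i _ => ?_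
  rw [Finset.sum_comm]
  refine Finset.sum_congr rfl fun j _ => ?_
  rw [Finset.sum_comm]
  refine Finset.sum_congr rfl fun k _ => ?_
  rw [Finset.sum_comm]
  refine Finset.sum_congr rfl fun l _ => ?_
  rw [← Finset.mul_sum, h4]
  ring

/-! ### Isometries with $h^3=1$: traces and root orbits. -/

section Isometry

variable (h : E8 ≃ₗ[ℤ] E8)

/-- The matrix of an automorphism of `ℤ⁸`. -/
def matrixOf : Matrix (Fin 8) (Fin 8) ℤ := LinearMap.toMatrix' (h : E8 →ₗ[ℤ] E8)

theorem matrixOf_mulVec (x : E8) : (matrixOf h).mulVec x = h x := by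
  rw [matrixOf, LinearMap.toMatrix'_mulVec]; rfl

variable {h}

theorem matrixOf_isometry (hh : h ∈ isometryGroup formE8) :
    (matrixOf h).transpose * (CartanMatrix.E₈ * matrixOf h) = CartanMatrix.E₈ := by
  ext i j
  have := hh (Pi.single i 1) (Pi.single j 1)
  rw [formE8_apply, formE8_apply, ← matrixOf_mulVec, ← matrixOf_mulVec, Matrix.mulVec_mulVec,
    Matrix.dotProduct_mulVec, Matrix.vecMul_mulVec, ← Matrix.dotProduct_mulVec] at this
  simpa using this

theorem matrixOf_pow_three (h3 : ∀ x, h (h (h x)) = x) :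
    matrixOf h * (matrixOf h * matrixOf h) = 1 := by
  refine Matrix.mulVec_injective (funext fun x => ?_)
  simp only [← Matrix.mulVec_mulVec, matrixOf_mulVec, h3, Matrix.one_mulVec]

theorem cartanMatrix_E₈_transpose : CartanMatrix.E₈.transpose = CartanMatrix.E₈ := by
  decide +kernel

theorem E8_mul_gramInv : CartanMatrix.E₈ * gramInv.map (Nat.cast : ℕ → ℤ) = 1 :=
  mul_eq_one_comm.1 gramInv_mul

theorem adjoint_mul_matrixOf (hh : h ∈ isometryGroup formE8) :
    gramInv.map (Nat.cast : ℕ → ℤ) * (matrixOf h).transpose * CartanMatrix.E₈ * matrixOf h = 1 := by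
  rw [mul_assoc, mul_assoc, matrixOf_isometry hh, gramInv_mul]

/-- The square of $h$ is its inverse, hence its adjoint for the form, and an adjoint has the same
trace. -/
theorem trace_matrixOf_sq (hh : h ∈ isometryGroup formE8) (h3 : ∀ x, h (h (h x)) = x) :
    (matrixOf h * matrixOf h).trace = (matrixOf h).trace := by
  have h1 := adjoint_mul_matrixOf hh
  have h2 := matrixOf_pow_three h3
  have : matrixOf h * matrixOf h =
      gramInv.map (Nat.cast : ℕ → ℤ) * (matrixOf h).transpose * CartanMatrix.E₈ := by
    refine (left_inv_eq_right_inv h1 h2).symm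
  rw [this, Matrix.trace_mul_comm, ← mul_assoc, E8_mul_gramInv, one_mul, Matrix.trace_transpose]

theorem formE8_apply_map (x : E8) :
    formE8 x (h x) = x ⬝ᵥ (CartanMatrix.E₈ * matrixOf h).mulVec x := by
  rw [formE8_apply, ← matrixOf_mulVec, Matrix.mulVec_mulVec]

theorem trace_E8_mul_matrixOf :
    (CartanMatrix.E₈ * matrixOf h * gramInv.map (Nat.cast : ℕ → ℤ)).trace =
      (matrixOf h).trace := by
  rw [Matrix.trace_mul_comm, ← mul_assoc, gramInv_mul, one_mul]

theorem sum_formE8_map : ∑ a ∈ posRoots, formE8 a (h a) = 30 * (matrixOf h).trace := by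
  simp only [formE8_apply_map]
  rw [sum_posRoots_bilin, trace_E8_mul_matrixOf]

/-- The three pairings in the fourth moment contribute $(\operatorname{tr} h)^2$,
$\operatorname{tr}(h^*h)=8$ and $\operatorname{tr}(h^2)=\operatorname{tr} h$. -/
theorem sum_formE8_map_sq (hh : h ∈ isometryGroup formE8) (h3 : ∀ x, h (h (h x)) = x) :
    ∑ a ∈ posRoots, formE8 a (h a) ^ 2 =
      6 * ((matrixOf h).trace ^ 2 + 8 + (matrixOf h).trace) := by
  simp only [formE8_apply_map]
  rw [sum_posRoots_bilin_sq _ _ rfl, trace_E8_mul_matrixOf]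
  have hc := mul_eq_one_comm.1 (adjoint_mul_matrixOf hh)
  have hG := E8_mul_gramInv
  have hQ := gramInv_mul
  rw [Matrix.transpose_mul, cartanMatrix_E₈_transpose]
  set Q := gramInv.map (Nat.cast : ℕ → ℤ)
  set H := matrixOf h
  have e1 : CartanMatrix.E₈ * H * Q * (H.transpose * CartanMatrix.E₈ * Q) = 1 := by
    calc _ = CartanMatrix.E₈ * (H * (Q * H.transpose * CartanMatrix.E₈)) * Q := by
          simp only [mul_assoc]
      _ = 1 := by rw [hc, mul_one, hG]
  have e2 : CartanMatrix.E₈ * H * Q * (CartanMatrix.E₈ * H * Q) =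
      CartanMatrix.E₈ * (H * H * Q) := by
    calc _ = CartanMatrix.E₈ * (H * (Q * CartanMatrix.E₈) * H * Q) := by simp only [mul_assoc]
      _ = _ := by rw [hQ, mul_one]
  rw [e1, e2, Matrix.trace_mul_comm, mul_assoc, hQ, mul_one, trace_matrixOf_sq hh h3]
  simp [H]

/-- Modulo $3$ one has $(h-1)^3=h^3-1=0$, so $h-1$ is nilpotent and has trace zero. -/
theorem trace_matrixOf_mod (h3 : ∀ x, h (h (h x)) = x) : (3 : ℤ) ∣ (matrixOf h).trace - 8 := by
  have h1 := congrArg (fun M => M.map (Int.castRingHom (ZMod 3))) (matrixOf_pow_three h3)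
  simp only [Matrix.map_mul] at h1
  rw [Matrix.map_one _ (map_zero _) (map_one _)] at h1
  have ht : (((matrixOf h).map (Int.castRingHom (ZMod 3))).trace) =
      ((matrixOf h).trace : ZMod 3) := by
    simp [Matrix.trace]
  set N := (matrixOf h).map (Int.castRingHom (ZMod 3)) with hN
  have h30 : (3 : Matrix (Fin 8) (Fin 8) (ZMod 3)) = 0 := by decide +kernel
  have hnil : IsNilpotent (N - 1) := ⟨3, by
    calc (N - 1) ^ 3 = N * (N * N) - 1 - 3 * (N * N - N) := by noncomm_ring
      _ = 0 := by rw [h1, h30]; simp⟩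
  have := (Matrix.isNilpotent_trace_of_isNilpotent hnil).eq_zero
  rw [Matrix.trace_sub, ht, Matrix.trace_one, Fintype.card_fin] at this
  refine (ZMod.intCast_zmod_eq_zero_iff_dvd _ 3).1 ?_
  push_cast at this ⊢
  exact this

/-- The lower bound and its equality case come from the norm $6+6(a,ha)$ of the orbit sum; the upper
ones are Cauchy–Schwarz. -/
theorem formE8_self_map_bounds (hh : h ∈ isometryGroup formE8) (h3 : ∀ x, h (h (h x)) = x)
    {a : E8} (ha : formE8 a a = 2) :
    -1 ≤ formE8 a (h a) ∧ formE8 a (h a) ≤ 2 ∧ (formE8 a (h a) = 2 → h a = a) ∧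
      (formE8 a (h a) = -1 → a + h a + h (h a) = 0) := by
  have e1 : formE8 (h a) (h (h a)) = formE8 a (h a) := hh _ _
  have e2 : formE8 a (h (h a)) = formE8 a (h a) := by
    rw [← hh a (h (h a)), h3, formE8_comm]
  have e3 : formE8 (h a) (h a) = 2 := by rw [hh, ha]
  have e4 : formE8 (h (h a)) (h (h a)) = 2 := by rw [hh, e3]
  have e5 : formE8 (a + h a + h (h a)) (a + h a + h (h a)) = 6 + 6 * formE8 a (h a) := by
    simp only [map_add, LinearMap.add_apply, formE8_comm (h a) a, formE8_comm (h (h a)) a,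
      formE8_comm (h (h a)) (h a), e1, e2, e3, e4, ha]
    ring
  have hc := formE8_le_two ha e3
  refine ⟨?_, hc.1, fun hs => (hc.2 hs).symm, fun hs => ?_⟩
  · linarith [formE8_self_nonneg (a + h a + h (h a))]
  · exact formE8_self_eq_zero (by rw [e5, hs]; norm_num)

theorem eq_one_of_posRoots (hf : ∀ a ∈ posRoots, h a = a) : h = 1 := by
  refine LinearEquiv.toLinearMap_injective ?_
  refine LinearMap.pi_ext' fun i => LinearMap.ext_ring ?_
  exact hf _ (single_mem_posRoots i)

/-- An isometry of `E₈` of order three has a root whose orbit sum vanishes. -/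
theorem exists_root_orbit_sum_eq_zero (hh : h ∈ isometryGroup formE8)
    (h3 : ∀ x, h (h (h x)) = x) (hne : h ≠ 1) :
    ∃ b : E8, formE8 b b = 2 ∧ b + h b + h (h b) = 0 := by
  by_contra! hno
  have hs : ∀ a ∈ posRoots, formE8 a (h a) = 0 ∨ formE8 a (h a) = 2 := fun a ha => by
    have ha2 := formE8_posRoots_self ha
    obtain ⟨h1, h2, -, h4⟩ := formE8_self_map_bounds hh h3 ha2
    have h5 : formE8 a (h a) ≠ -1 := fun h => hno a ha2 (h4 h)
    -- If the product is $1$, then `h a - a` is a root, and its orbit sum telescopes to zero.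
    have h6 : formE8 a (h a) ≠ 1 := fun h6 => by
      refine hno (h a - a) ?_ ?_
      · have : formE8 (h a) (h a) = 2 := by rw [hh, ha2]
        simp only [map_sub, LinearMap.sub_apply, formE8_comm (h a) a, h6, this, ha2]
        norm_num
      · simp only [map_sub, h3]
        abel
    omega
  have hsum : ∑ a ∈ posRoots, formE8 a (h a) ^ 2 = 2 * ∑ a ∈ posRoots, formE8 a (h a) := by
    rw [Finset.mul_sum]
    refine Finset.sum_congr rfl fun a ha => ?_
    rcases hs a ha with h | h <;> rw [h] <;> norm_num
  rw [sum_formE8_map_sq hh h3, sum_formE8_map] at hsum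
  have hm := trace_matrixOf_mod h3
  have ht : (matrixOf h).trace = 8 := by
    -- The moments give $6(t^2+8+t)=60t$; the root $t=1$ is excluded modulo $3$.
    have : ((matrixOf h).trace - 1) * ((matrixOf h).trace - 8) = 0 := by linarith
    rcases mul_eq_zero.1 this with h | h <;> omega
  refine hne (eq_one_of_posRoots fun a ha => ?_)
  have h0 : ∑ a ∈ posRoots, (2 - formE8 a (h a)) = 0 := by
    rw [Finset.sum_sub_distrib, sum_formE8_map, ht, Finset.sum_const, card_posRoots]
    norm_num
  have hnn : ∀ a ∈ posRoots, 0 ≤ 2 - formE8 a (h a) := fun a ha => by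
    have := (formE8_self_map_bounds hh h3 (formE8_posRoots_self ha)).2.1
    linarith
  have := (Finset.sum_eq_zero_iff_of_nonneg hnn).1 h0 a ha
  exact (formE8_self_map_bounds hh h3 (formE8_posRoots_self ha)).2.2.1 (by linarith)

end Isometry

/-! ### Rotations of order three in an $A_2$-plane. -/

section Rotation

/-- The rotation `b ↦ c ↦ -b - c` of the plane spanned by two roots `b`, `c` with product `-1`. -/
def rotationMap (b c : E8) : E8 →ₗ[ℤ] E8 :=
  LinearMap.id - (formE8.flip b + formE8.flip c).smulRight b - (formE8.flip c).smulRight c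

theorem rotationMap_apply (b c x : E8) :
    rotationMap b c x = x - (formE8 x b + formE8 x c) • b - formE8 x c • c := rfl

variable {b c : E8}

theorem rotationMap_rotationMap (hb : formE8 b b = 2) (hc : formE8 c c = 2)
    (hbc : formE8 b c = -1) (x : E8) :
    rotationMap b c (rotationMap b c x) = x - formE8 x b • b - (formE8 x b + formE8 x c) • c := by
  have hcb : formE8 c b = -1 := by rw [formE8_comm, hbc]
  simp only [rotationMap_apply, map_sub, map_smul, hb, hc, hbc, hcb]
  module

theorem rotationMap_cube (hb : formE8 b b = 2) (hc : formE8 c c = 2)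
    (hbc : formE8 b c = -1) (x : E8) :
    rotationMap b c (rotationMap b c (rotationMap b c x)) = x := by
  have hcb : formE8 c b = -1 := by rw [formE8_comm, hbc]
  rw [rotationMap_rotationMap hb hc hbc]
  simp only [rotationMap_apply, map_sub, LinearMap.sub_apply, map_smul, LinearMap.smul_apply,
    hb, hc, hbc, hcb, smul_eq_mul]
  module

theorem formE8_rotationMap (hb : formE8 b b = 2) (hc : formE8 c c = 2)
    (hbc : formE8 b c = -1) (x y : E8) :
    formE8 (rotationMap b c x) (rotationMap b c y) = formE8 x y := by
  have hcb : formE8 c b = -1 := by rw [formE8_comm, hbc]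
  simp only [rotationMap_apply, map_sub, LinearMap.sub_apply, map_smul, LinearMap.smul_apply,
    hb, hc, hbc, hcb, smul_eq_mul, formE8_comm b y, formE8_comm c y]
  ring

/-- `rotationMap` as an automorphism. -/
def rotation (hb : formE8 b b = 2) (hc : formE8 c c = 2)
    (hbc : formE8 b c = -1) : E8 ≃ₗ[ℤ] E8 :=
  LinearEquiv.ofLinearMap (rotationMap b c) (rotationMap b c ∘ₗ rotationMap b c)
    (LinearMap.ext (rotationMap_cube hb hc hbc)) (LinearMap.ext (rotationMap_cube hb hc hbc))

end Rotation

/-! ### Decomposition into rotations of orthogonal planes. -/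

/-- A family of roots spanning, together with their images, mutually orthogonal planes on which
`h` acts as a rotation of order three, while `h` is trivial on the orthogonal complement. -/
structure IsFrame (h : E8 ≃ₗ[ℤ] E8) {n : ℕ} (β : Fin n → E8) : Prop where
  root : ∀ i, formE8 (β i) (β i) = 2
  orbit_sum : ∀ i, β i + h (β i) + h (h (β i)) = 0
  orthogonal : ∀ i j, i ≠ j → formE8 (β i) (β j) = 0
  orthogonal_map : ∀ i j, i ≠ j → formE8 (β i) (h (β j)) = 0
  fixed : ∀ x, (∀ i, formE8 x (β i) = 0 ∧ formE8 x (h (β i)) = 0) → h x = x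

variable {h : E8 ≃ₗ[ℤ] E8}

/-- A fixed vector has the same product with all three vectors of an orbit, so three times that
product vanishes. -/
theorem formE8_eq_zero_of_orbit_sum (hh : h ∈ isometryGroup formE8) {x y : E8}
    (hx : x + h x + h (h x) = 0) (hy : h y = y) : formE8 x y = 0 := by
  have h1 : formE8 (h x) y = formE8 x y := by conv_lhs => rw [← hy, hh]
  have h2 : formE8 (h (h x)) y = formE8 x y := by conv_lhs => rw [← hy, hh, h1]
  have h3 : formE8 (x + h x + h (h x)) y = 3 * formE8 x y := by
    rw [map_add formE8, map_add formE8, LinearMap.add_apply, LinearMap.add_apply, h1, h2]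
    ring
  rw [hx, map_zero, LinearMap.zero_apply] at h3
  omega

theorem mem_fixedLattice {x : E8} : x ∈ fixedLattice h ↔ h x = x := by
  simp [fixedLattice, LinearMap.mem_ker, sub_eq_zero]

theorem orbit_sum_root (hh : h ∈ isometryGroup formE8) {b : E8} (hb : formE8 b b = 2)
    (hs : b + h b + h (h b) = 0) : formE8 b (h b) = -1 := by
  have h1 : formE8 (h b) (h b) = 2 := by rw [hh, hb]
  have h2 : formE8 (h (h b)) (h (h b)) = 2 := by rw [hh, h1]
  have h3 : h (h b) = -(b + h b) := by
    rw [eq_neg_iff_add_eq_zero, add_comm, hs]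
  rw [h3] at h2
  simp only [map_neg, map_add, LinearMap.neg_apply, LinearMap.add_apply, formE8_comm (h b) b, h1,
    hb] at h2
  linarith

theorem exists_isFrame (hh : h ∈ isometryGroup formE8) (h3 : ∀ x, h (h (h x)) = x) :
    ∃ (n : ℕ) (β : Fin n → E8), IsFrame h β := by
  -- Submodules of $\mathbb Z^8$ satisfy the ascending chain condition, so the induction hypothesis
  -- covers isometries with a strictly larger fixed lattice.
  induction hF : fixedLattice h using WellFoundedGT.induction generalizing h with
  | ind F IH =>
  subst hF
  by_cases hne : h = 1
  · subst hne
    exact ⟨0, Fin.elim0, fun i => i.elim0, fun i => i.elim0, fun i => i.elim0, fun i => i.elim0,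
      fun _ _ => rfl⟩
  obtain ⟨b, hb, hbs⟩ := exists_root_orbit_sum_eq_zero hh h3 hne
  have hbc := orbit_sum_root hh hb hbs
  have hc : formE8 (h b) (h b) = 2 := by rw [hh, hb]
  have hcb : formE8 (h b) b = -1 := by rw [formE8_comm, hbc]
  have hd : h (h b) = -b - h b := by
    rw [← sub_eq_zero, ← hbs]; abel
  set s := rotation hb hc hbc with hs
  have hsa : ∀ x, s x = rotationMap b (h b) x := fun _ => rfl
  have hsO : s ∈ isometryGroup formE8 := formE8_rotationMap hb hc hbc
  have hs3 : s ^ 3 = 1 := LinearEquiv.ext (rotationMap_cube hb hc hbc)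
  have hh3 : h ^ 3 = 1 := LinearEquiv.ext h3
  have hsb : s b = h b := by
    rw [hsa, rotationMap_apply, hb, hbc]; module
  have hsc : s (h b) = h (h b) := by
    rw [hsa, rotationMap_apply, hc, hcb, hd]; module
  have hcomm : Commute s h := LinearEquiv.ext fun x => by
    have e1 : formE8 (h x) (h b) = formE8 x b := hh _ _
    have e2 : formE8 (h x) b = -formE8 x b - formE8 x (h b) := by
      have : b = h (h (h b)) := (h3 b).symm
      rw [this, hh, h3, hd, map_sub, map_neg]
    rw [LinearEquiv.mul_apply, LinearEquiv.mul_apply, hsa, hsa, rotationMap_apply,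
      rotationMap_apply, e1, e2]
    simp only [map_sub, map_smul, hd]
    module
  set g := s⁻¹ * h with hg
  have hsg : ∀ x, s (g x) = h x := fun x => by
    rw [← LinearEquiv.mul_apply, hg, mul_inv_cancel_left]
  have hgO : g ∈ isometryGroup formE8 := mul_mem (inv_mem hsO) hh
  have hg3 : ∀ x, g (g (g x)) = x := fun x => by
    have : g ^ 3 = 1 := by rw [hg, (hcomm.inv_left).mul_pow, inv_pow, hs3, hh3]; simp
    exact LinearEquiv.congr_fun this x
  have hgb : g b = b := s.injective (by rw [hsg, hsb])
  have hgc : g (h b) = h b := s.injective (by rw [hsg, hsc])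
  have hperp : ∀ x, formE8 x b = 0 → formE8 x (h b) = 0 → s x = x := fun x h1 h2 => by
    rw [hsa, rotationMap_apply, h1, h2]; module
  have hlt : fixedLattice h < fixedLattice g := by
    refine lt_of_le_of_ne (fun x hx => ?_) fun heq => ?_
    · rw [mem_fixedLattice] at hx ⊢
      have h1 : formE8 x b = 0 := by
        rw [formE8_comm]; exact formE8_eq_zero_of_orbit_sum hh hbs hx
      have h2 : formE8 x (h b) = 0 := by
        rw [← hx, hh, h1]
      exact s.injective (by rw [hsg, hx, hperp x h1 h2])
    · have : b ∈ fixedLattice h := by rw [heq, mem_fixedLattice, hgb]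
      have := formE8_eq_zero_of_orbit_sum hh hbs (mem_fixedLattice.1 this)
      omega
  obtain ⟨n, β, hβ⟩ := IH _ hlt hgO hg3 rfl
  have ob : ∀ i, formE8 (β i) b = 0 := fun i =>
    formE8_eq_zero_of_orbit_sum hgO (hβ.orbit_sum i) hgb
  have oc : ∀ i, formE8 (β i) (h b) = 0 := fun i =>
    formE8_eq_zero_of_orbit_sum hgO (hβ.orbit_sum i) hgc
  -- Since `g` fixes `b` and `h b`, it preserves their orthogonal complement, where `s` is trivial.
  have eqg : ∀ x, formE8 x b = 0 → formE8 x (h b) = 0 → h x = g x := fun x h1 h2 => by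
    rw [← hsg]
    refine hperp _ ?_ ?_
    · conv_lhs => rw [← hgb, hgO, h1]
    · conv_lhs => rw [← hgc, hgO, h2]
  have hgβ : ∀ i, h (β i) = g (β i) := fun i => eqg _ (ob i) (oc i)
  have ogb : ∀ i, formE8 (g (β i)) b = 0 := fun i => by conv_lhs => rw [← hgb, hgO, ob]
  have ogc : ∀ i, formE8 (g (β i)) (h b) = 0 := fun i => by conv_lhs => rw [← hgc, hgO, oc]
  refine ⟨n + 1, Fin.cons b β, ⟨?_, ?_, ?_, ?_, ?_⟩⟩
  · exact Fin.cases hb hβ.root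
  · refine Fin.cases hbs fun i => ?_
    simp only [Fin.cons_succ]
    rw [hgβ, eqg _ (ogb i) (ogc i)]
    exact hβ.orbit_sum i
  · refine Fin.cases (Fin.cases (fun h => (h rfl).elim) fun j _ => ?_)
      fun i => Fin.cases (fun _ => ?_) fun j hij => ?_
    · simp [formE8_comm b, ob]
    · simp [ob]
    · simpa using hβ.orthogonal i j fun h => hij (by rw [h])
  · refine Fin.cases (Fin.cases (fun h => (h rfl).elim) fun j _ => ?_)
      fun i => Fin.cases (fun _ => ?_) fun j hij => ?_
    · simp [formE8_comm b, hgβ, ogb]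
    · simp [oc]
    · simpa [hgβ] using hβ.orthogonal_map i j fun h => hij (by rw [h])
  · intro x hx
    have hx0 := hx 0
    simp only [Fin.cons_zero] at hx0
    rw [eqg x hx0.1 hx0.2]
    refine hβ.fixed x fun i => ?_
    have := hx i.succ
    simp only [Fin.cons_succ] at this
    exact ⟨this.1, by rw [← hgβ]; exact this.2⟩

/-! ### One or two planes: the displacement of some vector is a root. -/

/-- Otherwise $c\in 3E_8$ by unimodularity, and its norm would be a multiple of $9$. -/
theorem exists_not_three_dvd_formE8 {c : E8} (hc : formE8 c c = 6) : ∃ x, ¬ 3 ∣ formE8 x c := by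
  by_contra! hall
  obtain ⟨y, rfl⟩ := exists_smul_of_dvd_formE8 hall
  simp only [map_smul, LinearMap.smul_apply, smul_eq_mul] at hc
  omega

/-- Two orthogonal vectors of norm six are independent modulo three. -/
theorem exists_not_three_dvd_and_dvd {c d : E8} (hc : formE8 c c = 6) (hd : formE8 d d = 6)
    (hcd : formE8 c d = 0) : ∃ x, ¬ 3 ∣ formE8 x c ∧ 3 ∣ formE8 x d := by
  by_contra! hno
  have hdvd : ∀ x, 3 ∣ formE8 x d → 3 ∣ formE8 x c := fun x hx => by
    by_contra h
    exact hno x h hx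
  obtain ⟨z, hz⟩ := exists_not_three_dvd_formE8 hd
  obtain ⟨u, hu⟩ : ∃ u : ℤ, 3 ∣ u * formE8 z d - 1 := by
    rcases (by omega : formE8 z d % 3 = 1 ∨ formE8 z d % 3 = 2) with h | h
    · exact ⟨1, by omega⟩
    · exact ⟨2, by omega⟩
  -- If the kernel of $(\cdot,d)$ modulo $3$ lies in that of $(\cdot,c)$, then $c\equiv kd$ modulo
  -- $3E_8$, with $k$ found by evaluating at `z`. The norm $6+6k^2$ of $c-kd$ is then divisible by
  -- $9$, which makes $-1$ a square modulo $3$.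
  set k := u * formE8 z c with hk
  have hdiv : ∀ x, 3 ∣ formE8 x (c - k • d) := fun x => by
    have h1 := hdvd (x - (formE8 x d * u) • z) (by
      obtain ⟨m, hm⟩ := hu
      refine ⟨-(formE8 x d * m), ?_⟩
      simp only [map_sub, LinearMap.sub_apply, map_smul, LinearMap.smul_apply, smul_eq_mul]
      linear_combination -(formE8 x d) * hm)
    simp only [map_sub, LinearMap.sub_apply, map_smul, LinearMap.smul_apply, smul_eq_mul] at h1 ⊢
    rw [hk]
    convert h1 using 1
    ring
  obtain ⟨y, hy⟩ := exists_smul_of_dvd_formE8 hdiv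
  have h9 : 6 + 6 * k ^ 2 = 9 * formE8 y y := by
    have : formE8 (c - k • d) (c - k • d) = formE8 ((3 : ℤ) • y) ((3 : ℤ) • y) := by rw [hy]
    simp only [map_sub, LinearMap.sub_apply, map_smul, LinearMap.smul_apply, smul_eq_mul, hc, hd,
      hcd, formE8_comm d c] at this
    linear_combination this
  have h3 : (k ^ 2 + 1) % 3 = 0 := by omega
  rcases (by omega : k % 3 = 0 ∨ k % 3 = 1 ∨ k % 3 = 2) with h | h | h <;>
    simp [pow_two, Int.add_emod, Int.mul_emod, h] at h3

variable {h : E8 ≃ₗ[ℤ] E8}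

namespace IsFrame

variable {n : ℕ} {β : Fin n → E8}

theorem map_map (hβ : IsFrame h β) (i : Fin n) : h (h (β i)) = -β i - h (β i) := by
  rw [← sub_eq_zero, ← hβ.orbit_sum i]; abel

theorem formE8_map (hβ : IsFrame h β) (hh : h ∈ isometryGroup formE8) (i : Fin n) :
    formE8 (β i) (h (β i)) = -1 :=
  orbit_sum_root hh (hβ.root i) (hβ.orbit_sum i)

theorem formE8_combination_left (hβ : IsFrame h β) (hh : h ∈ isometryGroup formE8)
    (m m' : Fin n → ℤ) (k : Fin n) :
    formE8 (∑ j, (m j • β j + m' j • h (β j))) (β k) = 2 * m k - m' k := by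
  rw [map_sum, LinearMap.sum_apply, Finset.sum_eq_single k]
  · simp only [map_add, LinearMap.add_apply, map_smul, LinearMap.smul_apply, smul_eq_mul,
      hβ.root, formE8_comm (h (β k)), hβ.formE8_map hh]
    ring
  · intro j _ hj
    simp only [map_add, LinearMap.add_apply, map_smul, LinearMap.smul_apply, smul_eq_mul,
      hβ.orthogonal j k hj, formE8_comm (h (β j)), hβ.orthogonal_map k j hj.symm]
    ring
  · simp

theorem formE8_combination_right (hβ : IsFrame h β) (hh : h ∈ isometryGroup formE8)
    (m m' : Fin n → ℤ) (k : Fin n) :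
    formE8 (∑ j, (m j • β j + m' j • h (β j))) (h (β k)) = 2 * m' k - m k := by
  rw [map_sum, LinearMap.sum_apply, Finset.sum_eq_single k]
  · simp only [map_add, LinearMap.add_apply, map_smul, LinearMap.smul_apply, smul_eq_mul,
      hβ.root, hh (β k), hβ.formE8_map hh]
    ring
  · intro j _ hj
    simp only [map_add, LinearMap.add_apply, map_smul, LinearMap.smul_apply, smul_eq_mul,
      hβ.orthogonal j k hj, hh (β j), hβ.orthogonal_map j k hj]
    ring
  · simp

/-- The displacement of a vector whose products with the planes of the frame vanish except for
one plane. -/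
theorem map_sub_self (hβ : IsFrame h β) (hh : h ∈ isometryGroup formE8) (i : Fin n) {y : E8}
    (hy : ∀ j, j ≠ i → formE8 y (β j) = 0 ∧ formE8 y (h (β j)) = 0) :
    h y - y = -((formE8 y (β i) + formE8 y (h (β i))) • β i + formE8 y (h (β i)) • h (β i)) := by
  set P := formE8 y (β i)
  set Q := formE8 y (h (β i))
  -- Three times the orthogonal projection of `y` to the plane is subtracted from `3 y`; what
  -- remains is orthogonal to every plane of the frame.
  have hf := hβ.fixed ((3 : ℤ) • y - ((2 * P + Q) • β i + (P + 2 * Q) • h (β i))) fun j => by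
    rcases eq_or_ne j i with rfl | hj
    · simp only [map_sub, LinearMap.sub_apply, map_add, LinearMap.add_apply, map_smul,
        LinearMap.smul_apply, smul_eq_mul, hβ.root, hβ.formE8_map hh, hh (β j),
        formE8_comm (h (β j)) (β j)]
      constructor <;> ring
    · simp only [map_sub, LinearMap.sub_apply, map_add, LinearMap.add_apply, map_smul,
        LinearMap.smul_apply, smul_eq_mul, hh (β i), formE8_comm (h (β i)) (β j),
        hβ.orthogonal i j hj.symm, hβ.orthogonal_map i j hj.symm, hβ.orthogonal_map j i hj,
        (hy j hj).1, (hy j hj).2]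
      constructor <;> ring
  simp only [map_sub, map_add, map_smul, hβ.map_map] at hf
  have h3 : (3 : ℤ) • (h y - y) =
      (3 : ℤ) • (-((P + Q) • β i + Q • h (β i))) := by
    rw [← sub_eq_zero] at hf ⊢
    rw [← hf]
    module
  exact smul_right_injective E8 (by norm_num : (3 : ℤ) ≠ 0) h3

/-- The product with $\beta_j-h\beta_j$ modulo $3$ is the class in $A_2^*/A_2$ of the projection to
plane $j$. Adding vectors of the planes makes the projection zero where the class is trivial, and a
minimal vector of $A_2^*$, of norm $2/3$, in plane $i$. A rotation by $120°$ moves such a vector by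
a root. -/
theorem not_isRootless (hβ : IsFrame h β) (hh : h ∈ isometryGroup formE8) (i : Fin n) {x : E8}
    (hi : ¬ 3 ∣ formE8 x (β i - h (β i)))
    (hj : ∀ j, j ≠ i → 3 ∣ formE8 x (β j - h (β j))) : ¬ IsRootless formE8 h := by
  simp only [map_sub] at hi hj
  -- These are the coefficients of the correction. In plane `i` the corrected products with
  -- $\beta_i$ and $h\beta_i$ become $(1,0)$ or $(0,1)$, according to the nonzero class; elsewhere
  -- they become $(0,0)$.
  have hm : ∀ j, ∃ m m' : ℤ,
      (j ≠ i → formE8 x (β j) + (2 * m - m') = 0 ∧ formE8 x (h (β j)) + (2 * m' - m) = 0) ∧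
      (j = i → formE8 x (β j) + (2 * m - m') = 1 ∧ formE8 x (h (β j)) + (2 * m' - m) = 0 ∨
        formE8 x (β j) + (2 * m - m') = 0 ∧ formE8 x (h (β j)) + (2 * m' - m) = 1) := fun j => by
    rcases eq_or_ne j i with rfl | hne
    · set p := formE8 x (β j)
      set q := formE8 x (h (β j))
      rcases (by omega : 3 ∣ p - q - 1 ∨ 3 ∣ p - q + 1) with ⟨k, hk⟩ | ⟨k, hk⟩
      · exact ⟨-q - 2 * k, -q - k, fun h => (h rfl).elim, fun _ => Or.inl (by constructor <;> omega)⟩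
      · exact ⟨1 - q - 2 * k, 1 - q - k, fun h => (h rfl).elim,
          fun _ => Or.inr (by constructor <;> omega)⟩
    · obtain ⟨k, hk⟩ := hj j hne
      exact ⟨-formE8 x (h (β j)) - 2 * k, -formE8 x (h (β j)) - k,
        fun _ => by constructor <;> omega, fun h => (hne h).elim⟩
  choose m m' hm1 hm2 using hm
  set y := x + ∑ j, (m j • β j + m' j • h (β j)) with hy
  have hy1 : ∀ k, formE8 y (β k) = formE8 x (β k) + (2 * m k - m' k) := fun k => by
    rw [hy, map_add, LinearMap.add_apply, hβ.formE8_combination_left hh]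
  have hy2 : ∀ k, formE8 y (h (β k)) = formE8 x (h (β k)) + (2 * m' k - m k) := fun k => by
    rw [hy, map_add, LinearMap.add_apply, hβ.formE8_combination_right hh]
  have hmem : h y - y ∈ LinearMap.range ((h : E8 →ₗ[ℤ] E8) - LinearMap.id) := ⟨y, rfl⟩
  have hd := hβ.map_sub_self hh i (y := y) fun j hj => by rw [hy1, hy2]; exact hm1 j hj
  intro hr
  refine hr _ hmem ?_
  rw [hd, hy1, hy2]
  rcases hm2 i rfl with ⟨e1, e2⟩ | ⟨e1, e2⟩ <;> rw [e1, e2] <;>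
    simp only [map_neg, LinearMap.neg_apply, map_add, LinearMap.add_apply, map_smul,
      LinearMap.smul_apply, smul_eq_mul, hβ.root, hβ.formE8_map hh, hh (β i),
      formE8_comm (h (β i)) (β i)] <;> norm_num

theorem formE8_sub_map_self (hβ : IsFrame h β) (hh : h ∈ isometryGroup formE8) (i : Fin n) :
    formE8 (β i - h (β i)) (β i - h (β i)) = 6 := by
  simp only [map_sub, LinearMap.sub_apply, hβ.root, hβ.formE8_map hh, hh (β i),
      formE8_comm (h (β i)) (β i)]
  norm_num

theorem formE8_sub_map_of_ne (hβ : IsFrame h β) (hh : h ∈ isometryGroup formE8) {i j : Fin n}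
    (hij : i ≠ j) : formE8 (β i - h (β i)) (β j - h (β j)) = 0 := by
  simp only [map_sub, LinearMap.sub_apply, hβ.orthogonal i j hij, hβ.orthogonal_map i j hij,
    hh (β i), formE8_comm (h (β i)) (β j), hβ.orthogonal_map j i hij.symm]
  norm_num

/-- A rootless isometry has no frame of one or two planes. -/
theorem ne_one_ne_two (hβ : IsFrame h β) (hh : h ∈ isometryGroup formE8)
    (hr : IsRootless formE8 h) : n ≠ 1 ∧ n ≠ 2 := by
  refine ⟨?_, ?_⟩
  · rintro rfl
    obtain ⟨x, hx⟩ := exists_not_three_dvd_formE8 (hβ.formE8_sub_map_self hh 0)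
    exact hβ.not_isRootless hh 0 hx (fun j hj => (hj (Subsingleton.elim _ _)).elim) hr
  · rintro rfl
    obtain ⟨x, hx0, hx1⟩ := exists_not_three_dvd_and_dvd (hβ.formE8_sub_map_self hh 0)
      (hβ.formE8_sub_map_self hh 1) (hβ.formE8_sub_map_of_ne hh (by decide))
    refine hβ.not_isRootless hh 0 hx0 (fun j hj => ?_) hr
    obtain rfl : j = 1 := by omega
    exact hx1

end IsFrame

/-! ### Rootlessness when the fixed lattice is zero or $A_2$. -/

/-- The norm of the orbit sum of a vector whose displacement is a root. -/
theorem formE8_orbit_sum_of_root (hh : h ∈ isometryGroup formE8) (h3 : ∀ x, h (h (h x)) = x)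
    {x : E8} (hx : formE8 (h x - x) (h x - x) = 2) :
    formE8 (x + h x + h (h x)) (x + h x + h (h x)) = 9 * formE8 x x - 6 := by
  have e1 : formE8 (h x) (h (h x)) = formE8 x (h x) := hh _ _
  have e2 : formE8 x (h (h x)) = formE8 x (h x) := by
    rw [← hh x (h (h x)), h3, formE8_comm]
  have e3 : formE8 (h x) (h x) = formE8 x x := hh _ _
  have e4 : formE8 (h (h x)) (h (h x)) = formE8 x x := by rw [hh, e3]
  simp only [map_sub, map_add, LinearMap.sub_apply, LinearMap.add_apply, formE8_comm (h x) x,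
    formE8_comm (h (h x)) x, formE8_comm (h (h x)) (h x), e1, e2, e3, e4] at hx ⊢
  linarith

theorem isRootless_of_fixedLattice_eq_bot (hh : h ∈ isometryGroup formE8)
    (h3 : ∀ x, h (h (h x)) = x) (hF : fixedLattice h = ⊥) : IsRootless formE8 h := by
  rintro _ ⟨x, rfl⟩ hx
  have h1 := formE8_orbit_sum_of_root hh h3 hx
  have h2 : x + h x + h (h x) ∈ fixedLattice h := by
    rw [mem_fixedLattice, map_add, map_add, h3]; abel
  rw [hF, Submodule.mem_bot] at h2
  rw [h2, map_zero] at h1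
  omega

theorem latticeA_two_sum (u : latticeA 2) : u.1 0 + u.1 1 + u.1 2 = 0 := by
  have := u.2
  simpa [latticeA, LinearMap.mem_ker, Fin.sum_univ_three] using this

/-- A vector of `A₂` from its first two coordinates. -/
def mkA (a b : ℤ) : latticeA 2 := ⟨![a, b, -a - b], by
  simp [latticeA, LinearMap.mem_ker, Fin.sum_univ_three]⟩

theorem formA_two_apply (u v : latticeA 2) :
    formA 2 u v = u.1 0 * v.1 0 + u.1 1 * v.1 1 + u.1 2 * v.1 2 := by
  simp [formA, Matrix.toBilin'_apply', dotProduct, Fin.sum_univ_three]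

theorem latticeA_two_ext {u v : latticeA 2} (h0 : u.1 0 = v.1 0) (h1 : u.1 1 = v.1 1) : u = v := by
  have hu := latticeA_two_sum u
  have hv := latticeA_two_sum v
  ext i
  fin_cases i <;> simp <;> omega

/-- If $hx-x$ were a root, the orbit sum $z$ of $x$ would satisfy $(z,f)=3(x,f)$ for $f\in F$, so
$z\in 3A_2^*$. Norms there are $6a^2$ modulo $18$, while $z$ has norm $9(x,x)-6\equiv -6$ since
$E_8$ is even; again $-1$ would be a square modulo $3$. -/
theorem isRootless_of_isometric (hh : h ∈ isometryGroup formE8) (h3 : ∀ x, h (h (h x)) = x)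
    (hF : Isometric (formE8.restrict (fixedLattice h)) (formA 2)) : IsRootless formE8 h := by
  obtain ⟨e, he⟩ := hF
  rintro _ ⟨x, rfl⟩ hx
  have h1 := formE8_orbit_sum_of_root hh h3 hx
  have h2 : x + h x + h (h x) ∈ fixedLattice h := by
    rw [mem_fixedLattice, map_add, map_add, h3]; abel
  set z : fixedLattice h := ⟨_, h2⟩ with hz
  have hdiv : ∀ f : fixedLattice h, 3 ∣ formA 2 (e z) (e f) := fun f => by
    have hf := mem_fixedLattice.1 f.2
    rw [he]
    refine ⟨formE8 x f, ?_⟩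
    have e1 : formE8 (h x) f = formE8 x f := by conv_lhs => rw [← hf, hh]
    have e2 : formE8 (h (h x)) f = formE8 x f := by conv_lhs => rw [← hf, hh, e1]
    change formE8 (x + h x + h (h x)) f = _
    rw [map_add formE8, map_add formE8, LinearMap.add_apply, LinearMap.add_apply, e1, e2]
    ring
  have hzz : formA 2 (e z) (e z) = 9 * formE8 x x - 6 := by
    rw [he, ← h1]; rfl
  have d1 := hdiv (e.symm (mkA 1 (-1)))
  have d2 := hdiv (e.symm (mkA 1 0))
  rw [e.apply_symm_apply] at d1 d2
  have hs := latticeA_two_sum (e z)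
  rw [formA_two_apply] at d1 d2 hzz
  simp [mkA] at d1 d2
  obtain ⟨k, hk⟩ := d1
  obtain ⟨l, hl⟩ := d2
  set a := (e z).1 0
  obtain ⟨r, hr⟩ := even_formE8_self x
  have eb : (e z).1 1 = a - 3 * k := by linarith
  have ec : (e z).1 2 = -2 * a + 3 * k := by linarith
  rw [eb, ec] at hzz
  have h6 : 2 * (a * a + 1) = 3 * (formE8 x x + 2 * (a * k) - 2 * (k * k)) := by linarith
  have : (a * a + 1) % 3 = 0 := by omega
  rcases (by omega : a % 3 = 0 ∨ a % 3 = 1 ∨ a % 3 = 2) with h | h | h <;>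
    simp [Int.add_emod, Int.mul_emod, h] at this

/-! ### Embeddings of powers of $A_2$ and rank bounds. -/

/-- The coordinates of `A₂`. -/
def latticeATwoEquivProd : latticeA 2 ≃ₗ[ℤ] ℤ × ℤ where
  toFun u := (u.1 0, u.1 1)
  map_add' _ _ := rfl
  map_smul' _ _ := rfl
  invFun p := mkA p.1 p.2
  left_inv _ := latticeA_two_ext rfl rfl
  right_inv _ := rfl

theorem finrank_latticeA_two : Module.finrank ℤ (latticeA 2) = 2 := by
  rw [latticeATwoEquivProd.finrank_eq]; simp

theorem finrank_pow_latticeA_two (n : ℕ) : Module.finrank ℤ (Fin n → latticeA 2) = n * 2 := by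
  rw [Module.finrank_pi_fintype]
  simp [finrank_latticeA_two]

theorem formPow_apply {n : ℕ} (u v : Fin n → latticeA 2) :
    formPow (formA 2) n u v = ∑ i, formA 2 (u i) (v i) := by
  simp [formPow, LinearMap.sum_apply]

theorem formA_two_self_nonneg (u : latticeA 2) : 0 ≤ formA 2 u u := by
  rw [formA_two_apply]
  nlinarith [mul_self_nonneg (u.1 0), mul_self_nonneg (u.1 1), mul_self_nonneg (u.1 2)]

theorem formA_two_self_eq_zero {u : latticeA 2} (hu : formA 2 u u = 0) : u = 0 := by
  rw [formA_two_apply] at hu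
  have h0 := mul_self_nonneg (u.1 0)
  have h1 := mul_self_nonneg (u.1 1)
  have h2 := mul_self_nonneg (u.1 2)
  exact latticeA_two_ext (mul_self_eq_zero.1 (by linarith)) (mul_self_eq_zero.1 (by linarith))

theorem isIsometricEmbedding_of_map_form {n : ℕ} {φ : (Fin n → latticeA 2) →ₗ[ℤ] E8}
    (hφ : ∀ u v, formE8 (φ u) (φ v) = formPow (formA 2) n u v) :
    IsIsometricEmbedding (formPow (formA 2) n) formE8 φ where
  injective := by
    refine (injective_iff_map_eq_zero φ).2 fun u hu => ?_
    have := hφ u u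
    rw [hu, map_zero, formPow_apply] at this
    have h0 := (Finset.sum_eq_zero_iff_of_nonneg fun i _ => formA_two_self_nonneg (u i)).1 this.symm
    exact funext fun i => formA_two_self_eq_zero (h0 i (Finset.mem_univ i))
  map_form := hφ

/-- An injective map into `E₈` together with nonzero mutually orthogonal vectors that are
orthogonal to its range. -/
theorem finrank_add_le_eight {N : Type*} [AddCommGroup N] [Module.Free ℤ N] [Module.Finite ℤ N]
    {φ : N →ₗ[ℤ] E8} (hφ : Function.Injective φ) {r : ℕ} (y : Fin r → E8) (hy : ∀ i, y i ≠ 0)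
    (hyy : ∀ i j, i ≠ j → formE8 (y i) (y j) = 0) (hyφ : ∀ i v, formE8 (φ v) (y i) = 0) :
    Module.finrank ℤ N + r ≤ 8 := by
  let f : (N × (Fin r → ℤ)) →ₗ[ℤ] E8 := φ.coprod (Fintype.linearCombination ℤ y)
  have hf : Function.Injective f := by
    refine (injective_iff_map_eq_zero f).2 fun ⟨v, k⟩ hvk => ?_
    have hvk' : φ v + ∑ i, k i • y i = 0 := hvk
    have hk : k = 0 := funext fun i => by
      have h1 : formE8 (φ v + ∑ j, k j • y j) (y i) = 0 := by rw [hvk', map_zero]; rfl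
      rw [map_add, LinearMap.add_apply, hyφ, zero_add, map_sum, LinearMap.sum_apply,
        Finset.sum_eq_single i] at h1
      · rw [map_smul, LinearMap.smul_apply, smul_eq_mul] at h1
        exact (mul_eq_zero.1 h1).resolve_right (formE8_self_pos (hy i)).ne'
      · intro j _ hj
        rw [map_smul, LinearMap.smul_apply, hyy j i hj, smul_zero]
      · simp
    subst hk
    have hv : φ v = 0 := by simpa using hvk'
    rw [(injective_iff_map_eq_zero φ).1 hφ v hv]
    rfl
  have := LinearMap.finrank_le_finrank_of_injective hf
  simpa [Module.finrank_prod] using this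

theorem eq_zero_of_orthogonal_range {φ : A2pow4 →ₗ[ℤ] E8}
    (hφ : IsIsometricEmbedding (formPow (formA 2) 4) formE8 φ) {y : E8}
    (hy : ∀ v, formE8 (φ v) y = 0) : y = 0 := by
  by_contra hne
  have := finrank_add_le_eight hφ.injective (fun _ : Fin 1 => y) (fun _ => hne)
    (fun i j hij => (hij (Subsingleton.elim _ _)).elim) fun _ => hy
  rw [finrank_pow_latticeA_two] at this
  omega

/-- The sum of maps on the factors of a power of `A₂`. -/
def blockMap {n : ℕ} (f : Fin n → latticeA 2 →ₗ[ℤ] E8) : (Fin n → latticeA 2) →ₗ[ℤ] E8 :=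
  ∑ i, (f i).comp (LinearMap.proj i)

theorem blockMap_apply {n : ℕ} (f : Fin n → latticeA 2 →ₗ[ℤ] E8) (u : Fin n → latticeA 2) :
    blockMap f u = ∑ i, f i (u i) := by
  simp [blockMap, LinearMap.sum_apply]

theorem isIsometricEmbedding_blockMap {n : ℕ} {f : Fin n → latticeA 2 →ₗ[ℤ] E8}
    (hf : ∀ i u v, formE8 (f i u) (f i v) = formA 2 u v)
    (hff : ∀ i j, i ≠ j → ∀ u v, formE8 (f i u) (f j v) = 0) :
    IsIsometricEmbedding (formPow (formA 2) n) formE8 (blockMap f) := by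
  refine isIsometricEmbedding_of_map_form fun u v => ?_
  rw [blockMap_apply, blockMap_apply, formPow_apply]
  simp only [map_sum, LinearMap.sum_apply]
  refine Finset.sum_congr rfl fun i _ => ?_
  rw [Finset.sum_eq_single i]
  · exact hf i _ _
  · exact fun j _ hj => hff j i hj _ _
  · simp

/-- The map from `A₂` to the plane spanned by `b` and `c`; the index `t` selects one of the two
orientations. -/
def planeMap (b c : E8) (t : Fin 3) : latticeA 2 →ₗ[ℤ] E8 :=
  ((LinearMap.proj 0).comp (latticeA 2).subtype).smulRight b -
    ((LinearMap.proj t).comp (latticeA 2).subtype).smulRight c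

theorem planeMap_apply (b c : E8) (t : Fin 3) (u : latticeA 2) :
    planeMap b c t u = u.1 0 • b - u.1 t • c := rfl

theorem formE8_planeMap {b c : E8} (hb : formE8 b b = 2) (hc : formE8 c c = 2)
    (hbc : formE8 b c = -1) {t : Fin 3} (ht : t ≠ 0) (u v : latticeA 2) :
    formE8 (planeMap b c t u) (planeMap b c t v) = formA 2 u v := by
  have hcb : formE8 c b = -1 := by rw [formE8_comm, hbc]
  have hu := latticeA_two_sum u
  have hv := latticeA_two_sum v
  simp only [planeMap_apply, map_sub, LinearMap.sub_apply, map_smul, LinearMap.smul_apply,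
    smul_eq_mul, hb, hc, hbc, hcb]
  rw [formA_two_apply]
  have ht' : t = 1 ∨ t = 2 := by omega
  rcases ht' with rfl | rfl
  · have e1 : u.1 2 = -u.1 0 - u.1 1 := by linarith
    have e2 : v.1 2 = -v.1 0 - v.1 1 := by linarith
    rw [e1, e2]; ring
  · have e1 : u.1 1 = -u.1 0 - u.1 2 := by linarith
    have e2 : v.1 1 = -v.1 0 - v.1 2 := by linarith
    rw [e1, e2]; ring

theorem formE8_planeMap_eq_zero {b c : E8} {x : E8} (hb : formE8 x b = 0) (hc : formE8 x c = 0)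
    (t : Fin 3) (u : latticeA 2) : formE8 x (planeMap b c t u) = 0 := by
  simp only [planeMap_apply, map_sub, map_smul, hb, hc, smul_zero, sub_zero]

variable {h : E8 ≃ₗ[ℤ] E8}

namespace IsFrame

variable {n : ℕ} {β : Fin n → E8}

theorem formE8_planeMap_planeMap (hβ : IsFrame h β) (hh : h ∈ isometryGroup formE8) {t : Fin 3}
    {i j : Fin n} (hij : i ≠ j) (u v : latticeA 2) :
    formE8 (planeMap (β i) (h (β i)) t u) (planeMap (β j) (h (β j)) t v) = 0 := by
  simp only [planeMap_apply, map_sub, LinearMap.sub_apply, map_smul, LinearMap.smul_apply,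
    smul_eq_mul, hβ.orthogonal i j hij, hβ.orthogonal_map i j hij, hh (β i),
    formE8_comm (h (β i)) (β j), hβ.orthogonal_map j i hij.symm]
  norm_num

theorem formE8_planeMap_self (hβ : IsFrame h β) (hh : h ∈ isometryGroup formE8) {t : Fin 3}
    (ht : t ≠ 0) (i : Fin n) (u v : latticeA 2) :
    formE8 (planeMap (β i) (h (β i)) t u) (planeMap (β i) (h (β i)) t v) = formA 2 u v :=
  formE8_planeMap (hβ.root i) (by rw [hh, hβ.root]) (hβ.formE8_map hh i) ht u v

theorem isIsometricEmbedding (hβ : IsFrame h β) (hh : h ∈ isometryGroup formE8) {t : Fin 3}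
    (ht : t ≠ 0) : IsIsometricEmbedding (formPow (formA 2) n) formE8
      (blockMap fun i => planeMap (β i) (h (β i)) t) :=
  isIsometricEmbedding_blockMap (hβ.formE8_planeMap_self hh ht)
    fun _ _ hij => hβ.formE8_planeMap_planeMap hh hij

theorem le_four (hβ : IsFrame h β) (hh : h ∈ isometryGroup formE8) : n ≤ 4 := by
  have := finrank_add_le_eight (hβ.isIsometricEmbedding hh (t := 1) (by decide)).injective
    (Fin.elim0 : Fin 0 → E8) (fun i => i.elim0) (fun i => i.elim0) (fun i => i.elim0)
  rw [finrank_pow_latticeA_two] at this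
  omega

theorem formE8_fixed (hβ : IsFrame h β) (hh : h ∈ isometryGroup formE8) {x : E8} (hx : h x = x)
    (i : Fin n) : formE8 x (β i) = 0 ∧ formE8 x (h (β i)) = 0 := by
  have h1 : formE8 x (β i) = 0 := by
    rw [formE8_comm]; exact formE8_eq_zero_of_orbit_sum hh (hβ.orbit_sum i) hx
  exact ⟨h1, by conv_lhs => rw [← hx, hh, h1]⟩

/-- Vectors orthogonal to the $2n<8$ roots $\beta_i$, $h\beta_i$ are fixed, and for rank reasons
some are nonzero. -/
theorem fixedLattice_ne_bot (hβ : IsFrame h β) (hn : n < 4) : fixedLattice h ≠ ⊥ := by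
  intro hF
  let f : E8 →ₗ[ℤ] (Fin n → ℤ × ℤ) :=
    LinearMap.pi fun i => (formE8.flip (β i)).prod (formE8.flip (h (β i)))
  have hf : Function.Injective f := by
    refine (injective_iff_map_eq_zero f).2 fun x hx => ?_
    have : x ∈ fixedLattice h := mem_fixedLattice.2 (hβ.fixed x fun i => by
      have := congrFun hx i
      exact Prod.ext_iff.1 this)
    rwa [hF, Submodule.mem_bot] at this
  have := LinearMap.finrank_le_finrank_of_injective hf
  simp [Module.finrank_pi_fintype] at this
  omega

end IsFrame

theorem IsFrame.fixedLattice_eq_bot {β : Fin 4 → E8} (hβ : IsFrame h β)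
    (hh : h ∈ isometryGroup formE8) : fixedLattice h = ⊥ := by
  refine (Submodule.eq_bot_iff _).2 fun x hx => ?_
  have hx := hβ.formE8_fixed hh (mem_fixedLattice.1 hx)
  refine eq_zero_of_orthogonal_range (hβ.isIsometricEmbedding hh (t := 1) (by decide)) fun v => ?_
  rw [formE8_comm, blockMap_apply, map_sum]
  exact Finset.sum_eq_zero fun i _ => formE8_planeMap_eq_zero (hx i).1 (hx i).2 _ _

/-! ### Three planes: the fixed lattice of a rootless isometry. -/

/-- The number of positive roots fixed by a rootless isometry is determined by its trace. -/
theorem card_fixed_posRoots (hh : h ∈ isometryGroup formE8) (h3 : ∀ x, h (h (h x)) = x)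
    (hr : IsRootless formE8 h) :
    ((posRoots.filter fun a => h a = a).card : ℤ) =
      ((matrixOf h).trace + 2) * ((matrixOf h).trace + 4) := by
  -- The polynomial $s^2+s$ vanishes at $-1$ and $0$ and equals $6$ at $2$; rootlessness excludes
  -- $s=1$. Summing it therefore counts the fixed roots.
  have hs : ∀ a ∈ posRoots, formE8 a (h a) ^ 2 + formE8 a (h a) = if h a = a then 6 else 0 := by
    intro a ha
    have ha2 := formE8_posRoots_self ha
    obtain ⟨h1, h2, h4, -⟩ := formE8_self_map_bounds hh h3 ha2
    have h6 : formE8 a (h a) ≠ 1 := fun h6 => by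
      refine hr (h a - a) ⟨a, rfl⟩ ?_
      have : formE8 (h a) (h a) = 2 := by rw [hh, ha2]
      simp only [map_sub, LinearMap.sub_apply, formE8_comm (h a) a, h6, this, ha2]
      norm_num
    split_ifs with hfix
    · rw [hfix, ha2]; norm_num
    · have h7 : formE8 a (h a) ≠ 2 := fun h => hfix (h4 h)
      rcases (by omega : formE8 a (h a) = 0 ∨ formE8 a (h a) = -1) with h | h <;> rw [h] <;>
        norm_num
  have := Finset.sum_congr rfl hs
  rw [Finset.sum_add_distrib, sum_formE8_map, sum_formE8_map_sq hh h3, ← Finset.sum_filter,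
    Finset.sum_const, nsmul_eq_mul] at this
  linarith

/-- From $(a,ha)\ge -1$ one gets $t\ge -4$. Equality would give all simple roots vanishing orbit
sums, so fixed vectors would be orthogonal to all of them and $F=0$. As $t\equiv 2 \pmod 3$, it
follows that $t\ge -1$, so $(t+2)(t+4)\ge 3$. -/
theorem two_lt_card_fixed_posRoots (hh : h ∈ isometryGroup formE8)
    (h3 : ∀ x, h (h (h x)) = x) (hr : IsRootless formE8 h) (hF : fixedLattice h ≠ ⊥) :
    2 < (posRoots.filter fun a => h a = a).card := by
  have hcard := card_fixed_posRoots hh h3 hr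
  have hm := trace_matrixOf_mod h3
  have hsum : ∑ a ∈ posRoots, (formE8 a (h a) + 1) = 30 * (matrixOf h).trace + 120 := by
    rw [Finset.sum_add_distrib, sum_formE8_map, Finset.sum_const, card_posRoots]
    norm_num
  have hnn : ∀ a ∈ posRoots, 0 ≤ formE8 a (h a) + 1 := fun a ha => by
    have := (formE8_self_map_bounds hh h3 (formE8_posRoots_self ha)).1
    linarith
  have hge := Finset.sum_nonneg hnn
  have hne : (matrixOf h).trace ≠ -4 := fun ht => by
    rw [ht] at hsum
    have h0 := (Finset.sum_eq_zero_iff_of_nonneg hnn).1 (by rw [hsum]; norm_num)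
    refine hF ((Submodule.eq_bot_iff _).2 fun x hx => ?_)
    have hx' : ∀ i : Fin 8, formE8 (Pi.single i 1) x = 0 := fun i => by
      have hi := single_mem_posRoots i
      have := (formE8_self_map_bounds hh h3 (formE8_posRoots_self hi)).2.2.2 (by linarith [h0 _ hi])
      exact formE8_eq_zero_of_orbit_sum hh this (mem_fixedLattice.1 hx)
    have hx0 : formE8.flip x = 0 := LinearMap.pi_ext' fun i => LinearMap.ext_ring (hx' i)
    exact formE8_self_eq_zero (LinearMap.congr_fun hx0 x)
  have ht : -1 ≤ (matrixOf h).trace := by omega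
  have : (3 : ℤ) ≤ ((posRoots.filter fun a => h a = a).card : ℤ) := by
    rw [hcard]; nlinarith
  omega

theorem formE8_posRoots_ne {a b : E8} (ha : a ∈ posRoots) (hb : b ∈ posRoots) (hab : a ≠ b) :
    formE8 a b = -1 ∨ formE8 a b = 0 ∨ formE8 a b = 1 := by
  have ha2 := formE8_posRoots_self ha
  have hb2 := formE8_posRoots_self hb
  have h1 := formE8_le_two ha2 hb2
  have h2 := formE8_le_two ha2 (y := -b) (by simp [hb2])
  have h3 : formE8 a b ≠ 2 := fun h => hab (h1.2 h)
  have h4 : formE8 a (-b) ≠ 2 := fun h => by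
    have hE := h2.2 h
    have : a = 0 := funext fun i => by
      have e1 := posRoots_nonneg ha i
      have e2 := posRoots_nonneg hb i
      have e3 : a i = -b i := congrFun hE i
      simp only [Pi.zero_apply]
      omega
    rw [this] at ha2
    simp at ha2
  rw [map_neg] at h2 h4
  omega

/-- Three mutually orthogonal fixed roots together with three planes would have rank $9$. Hence two
of the fixed positive roots have product $\pm1$, and the sign can be adjusted. -/
theorem exists_fixed_roots {β : Fin 3 → E8} (hβ : IsFrame h β) (hh : h ∈ isometryGroup formE8)
    (h3 : ∀ x, h (h (h x)) = x) (hr : IsRootless formE8 h) :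
    ∃ a b : E8, formE8 a a = 2 ∧ formE8 b b = 2 ∧ formE8 a b = -1 ∧ h a = a ∧ h b = b := by
  obtain ⟨a, ha, b, hb, c, hc, hab, hac, hbc⟩ := Finset.two_lt_card.1
    (two_lt_card_fixed_posRoots hh h3 hr (hβ.fixedLattice_ne_bot (by norm_num)))
  rw [Finset.mem_filter] at ha hb hc
  have key : ∀ x y : E8, x ∈ posRoots ∧ h x = x → y ∈ posRoots ∧ h y = y → x ≠ y →
      formE8 x y ≠ 0 → ∃ a b : E8, formE8 a a = 2 ∧ formE8 b b = 2 ∧ formE8 a b = -1 ∧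
        h a = a ∧ h b = b := by
    intro x y hx hy hxy hne
    rcases formE8_posRoots_ne hx.1 hy.1 hxy with h1 | h1 | h1
    · exact ⟨x, y, formE8_posRoots_self hx.1, formE8_posRoots_self hy.1, h1, hx.2, hy.2⟩
    · exact (hne h1).elim
    · exact ⟨x, -y, formE8_posRoots_self hx.1, by simp [formE8_posRoots_self hy.1],
        by rw [map_neg, h1], hx.2, by rw [map_neg, hy.2]⟩
  by_contra hno
  have o1 : formE8 a b = 0 := by_contra fun hne => hno (key a b ha hb hab hne)
  have o2 : formE8 a c = 0 := by_contra fun hne => hno (key a c ha hc hac hne)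
  have o3 : formE8 b c = 0 := by_contra fun hne => hno (key b c hb hc hbc hne)
  have hfix : ∀ i : Fin 3, h (![a, b, c] i) = ![a, b, c] i := by
    intro i; fin_cases i <;> simp [ha, hb, hc]
  have hne : ∀ x ∈ posRoots, x ≠ 0 := fun x hx h0 => by
    have := formE8_posRoots_self hx
    rw [h0] at this
    simp at this
  have := finrank_add_le_eight (hβ.isIsometricEmbedding hh (t := 1) (by decide)).injective
    ![a, b, c] (fun i => by fin_cases i <;> simp [hne, ha, hb, hc])
    (fun i j hij => by
      fin_cases i <;> fin_cases j <;> simp_all [formE8_comm b a, formE8_comm c a, formE8_comm c b])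
    (fun i v => by
      rw [formE8_comm, blockMap_apply, map_sum]
      have := hβ.formE8_fixed hh (hfix i)
      exact Finset.sum_eq_zero fun j _ => formE8_planeMap_eq_zero (this j).1 (this j).2 _ _)
  rw [finrank_pow_latticeA_two] at this
  omega

/-- The fixed lattice of a rootless isometry with a frame of three planes is isometric to `A₂`. -/
theorem isometric_fixedLattice {β : Fin 3 → E8} (hβ : IsFrame h β)
    (hh : h ∈ isometryGroup formE8) (h3 : ∀ x, h (h (h x)) = x) (hr : IsRootless formE8 h) :
    Isometric (formE8.restrict (fixedLattice h)) (formA 2) := by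
  obtain ⟨a, b, ha, hb, hab, hfa, hfb⟩ := exists_fixed_roots hβ hh h3 hr
  have hba : formE8 b a = -1 := by rw [formE8_comm, hab]
  have hemb : IsIsometricEmbedding (formPow (formA 2) 4) formE8
      (blockMap (Fin.snoc (α := fun _ => latticeA 2 →ₗ[ℤ] E8)
        (fun i => planeMap (β i) (h (β i)) 1) (planeMap a b 1))) := by
    refine isIsometricEmbedding_blockMap (fun i => ?_) fun i j => ?_
    · refine Fin.lastCases ?_ (fun i => ?_) i
      · simpa only [Fin.snoc_last] using formE8_planeMap ha hb hab (t := 1) (by decide)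
      · simpa only [Fin.snoc_castSucc] using hβ.formE8_planeMap_self hh (t := 1) (by decide) i
    · have ho : ∀ (i : Fin 3) (u v : latticeA 2),
          formE8 (planeMap a b 1 u) (planeMap (β i) (h (β i)) 1 v) = 0 := fun i u v => by
        have := hβ.formE8_fixed hh (x := planeMap a b 1 u)
          (by rw [planeMap_apply, map_sub, map_smul, map_smul, hfa, hfb]) i
        exact formE8_planeMap_eq_zero this.1 this.2 _ _
      refine Fin.lastCases (Fin.lastCases (fun h => (h rfl).elim) (fun j _ u v => ?_) j)
        (fun i => Fin.lastCases (fun _ u v => ?_) (fun j hij u v => ?_) j) i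
      · simpa only [Fin.snoc_last, Fin.snoc_castSucc] using ho j u v
      · simpa only [Fin.snoc_last, Fin.snoc_castSucc, formE8_comm (planeMap (β i) _ _ _)] using
          ho i v u
      · simpa only [Fin.snoc_castSucc] using
          hβ.formE8_planeMap_planeMap hh (fun h => hij (by rw [h])) u v
  -- The four planes have full rank, so three times a fixed vector equals three times its projection
  -- to the plane of `a` and `b`.
  have hspan : ∀ x, h x = x → ∃ u, planeMap a b 1 u = x := fun x hx => by
    set p := formE8 x a with hp
    set q := formE8 x b with hq
    have hz : (3 : ℤ) • x - ((2 * p + q) • a + (p + 2 * q) • b) = 0 := by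
      refine eq_zero_of_orthogonal_range hemb fun v => ?_
      rw [formE8_comm, blockMap_apply, Fin.sum_univ_castSucc, map_add, map_sum]
      have hfix : h ((3 : ℤ) • x - ((2 * p + q) • a + (p + 2 * q) • b)) =
          (3 : ℤ) • x - ((2 * p + q) • a + (p + 2 * q) • b) := by
        simp only [map_sub, map_add, map_smul, hx, hfa, hfb]
      have hf := hβ.formE8_fixed hh hfix
      rw [Finset.sum_eq_zero fun j _ => ?_, zero_add]
      · simp only [Fin.snoc_last]
        refine formE8_planeMap_eq_zero ?_ ?_ _ _ <;>
          simp only [map_sub, LinearMap.sub_apply, map_add, LinearMap.add_apply, map_smul,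
            LinearMap.smul_apply, smul_eq_mul, ha, hb, hab, hba, ← hp, ← hq] <;> ring
      · simp only [Fin.snoc_castSucc]
        exact formE8_planeMap_eq_zero (hf j).1 (hf j).2 _ _
    rw [sub_eq_zero] at hz
    -- Integrality of the norm of `x` forces $p\equiv q \pmod 3$: a nontrivial class of $A_2^*/A_2$
    -- has no vector of integral norm.
    have hn : 9 * formE8 x x = 2 * (2 * p + q) ^ 2 + 2 * (p + 2 * q) ^ 2
        - 2 * ((2 * p + q) * (p + 2 * q)) := by
      have := congrArg (fun y => formE8 y y) hz
      simp only [map_add, LinearMap.add_apply, map_smul,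
        LinearMap.smul_apply, smul_eq_mul, ha, hb, hab, hba] at this
      linear_combination this
    have hd : (2 * ((p - q) * (p - q))) % 3 = 0 := by
      have h2 : 3 * formE8 x x = 2 * ((p - q) * (p - q)) + 6 * (p * q) := by linarith
      omega
    have hpq : (p - q) % 3 = 0 := by
      rcases (by omega : (p - q) % 3 = 0 ∨ (p - q) % 3 = 1 ∨ (p - q) % 3 = 2) with h | h | h
      · exact h
      all_goals
        rw [Int.mul_emod, Int.mul_emod (p - q), h] at hd
        simp at hd
    obtain ⟨k, hk⟩ : ∃ k, p - q = 3 * k := ⟨(p - q) / 3, by omega⟩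
    -- With $p=q+3k$ one has $x=(q+2k)a+(q+k)b$; the second coordinate is negated because `planeMap`
    -- subtracts its second term.
    refine ⟨mkA (q + 2 * k) (-(q + k)), ?_⟩
    have : (3 : ℤ) • planeMap a b 1 (mkA (q + 2 * k) (-(q + k))) = (3 : ℤ) • x := by
      have hpk : p = q + 3 * k := by linarith
      rw [hz, planeMap_apply, hpk]
      change (3 : ℤ) • ((q + 2 * k) • a - (-(q + k)) • b) = _
      module
    exact smul_right_injective E8 (by norm_num : (3 : ℤ) ≠ 0) this
  let f : latticeA 2 →ₗ[ℤ] fixedLattice h := (planeMap a b 1).codRestrict (fixedLattice h)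
    fun u => mem_fixedLattice.2 (by
      rw [planeMap_apply, map_sub, map_smul, map_smul, hfa, hfb])
  have hf : ∀ u v, formE8.restrict (fixedLattice h) (f u) (f v) = formA 2 u v := fun u v =>
    formE8_planeMap ha hb hab (by decide) u v
  have hbij : Function.Bijective f := by
    refine ⟨(injective_iff_map_eq_zero f).2 fun u hu => formA_two_self_eq_zero ?_, fun x => ?_⟩
    · rw [← hf, hu]; simp
    · obtain ⟨u, hu⟩ := hspan x (mem_fixedLattice.1 x.2)
      exact ⟨u, Subtype.ext hu⟩
  refine ⟨(LinearEquiv.ofBijective f hbij).symm, fun x y => ?_⟩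
  obtain ⟨u, rfl⟩ := (LinearEquiv.ofBijective f hbij).surjective x
  obtain ⟨v, rfl⟩ := (LinearEquiv.ofBijective f hbij).surjective y
  rw [LinearEquiv.symm_apply_apply, LinearEquiv.symm_apply_apply]
  exact (hf u v).symm

/-! ### The glue code of an embedded $A_2^4$. -/

section Glue

variable {φ : A2pow4 →ₗ[ℤ] E8}

theorem eq_mkA (u : latticeA 2) : u = u.1 0 • mkA 1 0 + u.1 1 • mkA 0 1 :=
  latticeA_two_ext (by simp [mkA]) (by simp [mkA])

theorem formA_mkA (u : latticeA 2) (a b : ℤ) :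
    formA 2 u (mkA a b) = u.1 0 * (2 * a + b) + u.1 1 * (a + 2 * b) := by
  have := latticeA_two_sum u
  have e2 : u.1 2 = -u.1 0 - u.1 1 := by linarith
  rw [formA_two_apply, e2]
  simp only [mkA, Matrix.cons_val_zero, Matrix.cons_val_one, Matrix.cons_val]
  ring

theorem formE8_map_eq_sum (φ : A2pow4 →ₗ[ℤ] E8) (x : E8) (w : A2pow4) : formE8 x (φ w) =
    ∑ i, ((w i).1 0 * formE8 x (φ (Pi.single i (mkA 1 0)))
      + (w i).1 1 * formE8 x (φ (Pi.single i (mkA 0 1)))) := by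
  conv_lhs => rw [← Finset.univ_sum_single w]
  rw [map_sum, map_sum]
  refine Finset.sum_congr rfl fun i _ => ?_
  conv_lhs => rw [eq_mkA (w i)]
  rw [← LinearMap.single_apply (R := ℤ), ← LinearMap.single_apply (R := ℤ),
    ← LinearMap.single_apply (R := ℤ), map_add, map_smul, map_smul, map_add, map_smul, map_smul,
    map_add, map_smul, map_smul, smul_eq_mul, smul_eq_mul]

/-- Every vector of `E₈` becomes a vector of an embedded `A₂⁴` when multiplied by three. -/
theorem exists_map_eq_three_smul (hφ : IsIsometricEmbedding (formPow (formA 2) 4) formE8 φ)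
    (x : E8) : ∃ v, φ v = (3 : ℤ) • x ∧ ∀ i, 3 ∣ (v i).1 0 - (v i).1 1 ∧
      3 ∣ (v i).1 0 + formE8 x (φ (Pi.single i (mkA 1 1))) := by
  set p := fun i => formE8 x (φ (Pi.single i (mkA 1 0))) with hp
  set q := fun i => formE8 x (φ (Pi.single i (mkA 0 1))) with hq
  -- In each summand this is three times the projection of `x`, expressed through its products with
  -- the basis `mkA 1 0`, `mkA 0 1`.
  refine ⟨fun i => mkA (2 * p i - q i) (2 * q i - p i), ?_, fun i => ⟨⟨p i - q i, ?_⟩, ⟨p i, ?_⟩⟩⟩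
  · rw [← sub_eq_zero]
    refine eq_zero_of_orthogonal_range hφ fun w => ?_
    rw [map_sub, hφ.map_form, map_smul, formE8_comm (φ w), formE8_map_eq_sum, formPow_apply,
      smul_eq_mul, Finset.mul_sum, ← Finset.sum_sub_distrib]
    refine Finset.sum_eq_zero fun i _ => ?_
    rw [formA_mkA]
    ring
  · simp only [mkA, Matrix.cons_val_zero, Matrix.cons_val_one]
    ring
  · have : mkA 1 1 = mkA 1 0 + mkA 0 1 := latticeA_two_ext (by simp [mkA]) (by simp [mkA])
    rw [this, Pi.single_add, map_add, map_add]
    simp only [mkA, Matrix.cons_val_zero]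
    change 2 * p i - q i + (p i + q i) = _
    ring

theorem dvd_of_map_eq_three_smul (hφ : IsIsometricEmbedding (formPow (formA 2) 4) formE8 φ)
    {v : A2pow4} {x : E8} (hv : φ v = (3 : ℤ) • x) (i : Fin 4) : 3 ∣ (v i).1 0 - (v i).1 1 ∧
      3 ∣ (v i).1 0 + formE8 x (φ (Pi.single i (mkA 1 1))) := by
  obtain ⟨w, hw, hw'⟩ := exists_map_eq_three_smul hφ x
  obtain rfl : w = v := hφ.injective (by rw [hw, hv])
  exact hw' i

/-- The vectors $(1,1,-2)$ detect residues: by `exists_map_eq_three_smul`, the product of `x` with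
such a vector is minus the residue of `3 x`. Their norms allow `exists_not_three_dvd_and_dvd` to
produce code words. -/
theorem formE8_single_mkA (hφ : IsIsometricEmbedding (formPow (formA 2) 4) formE8 φ)
    (i j : Fin 4) : formE8 (φ (Pi.single i (mkA 1 1))) (φ (Pi.single j (mkA 1 1))) =
      if i = j then 6 else 0 := by
  rw [hφ.map_form, formPow_apply]
  split_ifs with h
  · subst h
    rw [Finset.sum_eq_single i (fun j _ hj => by simp [Pi.single_eq_of_ne hj]) (by simp)]
    simp [formA_two_apply, mkA]
  · refine Finset.sum_eq_zero fun k _ => ?_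
    rcases eq_or_ne k i with rfl | hk
    · simp [Pi.single_eq_of_ne h]
    · simp [Pi.single_eq_of_ne hk]

/-- The residue modulo three of the components of a vector of `A₂⁴`; on `3 (A₂*)⁴` it is the class
in the discriminant group. -/
def residue (v : A2pow4) (i : Fin 4) : ZMod 3 := ((v i).1 0 : ZMod 3)

theorem residue_add (v w : A2pow4) (i : Fin 4) :
    residue (v + w) i = residue v i + residue w i := by
  simp [residue]

theorem residue_eq_zero_iff {v : A2pow4} {i : Fin 4} : residue v i = 0 ↔ 3 ∣ (v i).1 0 :=
  ZMod.intCast_zmod_eq_zero_iff_dvd _ 3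

theorem exists_residue_ne_zero (hφ : IsIsometricEmbedding (formPow (formA 2) 4) formE8 φ)
    {i j : Fin 4} (hij : i ≠ j) :
    ∃ v x, φ v = (3 : ℤ) • x ∧ residue v i ≠ 0 ∧ residue v j = 0 := by
  obtain ⟨x, hx1, hx2⟩ := exists_not_three_dvd_and_dvd
    ((formE8_single_mkA hφ i i).trans (if_pos rfl)) ((formE8_single_mkA hφ j j).trans (if_pos rfl))
    ((formE8_single_mkA hφ i j).trans (if_neg hij))
  obtain ⟨v, hv, hv'⟩ := exists_map_eq_three_smul hφ x
  refine ⟨v, x, hv, ?_, ?_⟩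
  · rw [Ne, residue_eq_zero_iff]
    have := (hv' i).2
    omega
  · rw [residue_eq_zero_iff]
    have := (hv' j).2
    omega

/-- The norm of $3x$ is divisible by $9$, while a component with residue $r$ has norm $6r^2$ modulo
$18$. -/
theorem sum_residue_sq (hφ : IsIsometricEmbedding (formPow (formA 2) 4) formE8 φ)
    {v : A2pow4} {x : E8} (hv : φ v = (3 : ℤ) • x) : ∑ i, residue v i * residue v i = 0 := by
  choose k hk using fun i => (dvd_of_map_eq_three_smul hφ hv i).1
  have hn := hφ.map_form v v
  rw [hv, formPow_apply] at hn
  simp only [map_smul, LinearMap.smul_apply, smul_eq_mul] at hn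
  have hi : ∀ i, formA 2 (v i) (v i) = 6 * ((v i).1 0 * (v i).1 0)
      - 18 * ((v i).1 0 * k i) + 18 * (k i * k i) := fun i => by
    have e1 : (v i).1 1 = (v i).1 0 - 3 * k i := by linarith [hk i]
    have e2 : (v i).1 2 = -2 * (v i).1 0 + 3 * k i := by linarith [latticeA_two_sum (v i)]
    rw [formA_two_apply, e1, e2]
    ring
  simp only [hi, Finset.sum_add_distrib, Finset.sum_sub_distrib, ← Finset.mul_sum] at hn
  have h3 : (3 : ℤ) ∣ ∑ i, (v i).1 0 * (v i).1 0 := by omega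
  have := (ZMod.intCast_zmod_eq_zero_iff_dvd _ 3).2 h3
  push_cast at this
  exact this

/-- Polarisation of `sum_residue_sq`, as $2$ is invertible modulo $3$. -/
theorem sum_residue_mul (hφ : IsIsometricEmbedding (formPow (formA 2) 4) formE8 φ)
    {v w : A2pow4} {x y : E8} (hv : φ v = (3 : ℤ) • x) (hw : φ w = (3 : ℤ) • y) :
    ∑ i, residue v i * residue w i = 0 := by
  have hvw : φ (v + w) = (3 : ℤ) • (x + y) := by rw [map_add, hv, hw, smul_add]
  have h1 := sum_residue_sq hφ hvw
  have h2 := sum_residue_sq hφ hv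
  have h3 := sum_residue_sq hφ hw
  simp only [residue_add, Fin.sum_univ_four] at h1 h2 h3 ⊢
  have h4 : (3 : ZMod 3) = 0 := rfl
  linear_combination 2 * h1 - 2 * h2 - 2 * h3 - h4 * (residue v 0 * residue w 0
    + residue v 1 * residue w 1 + residue v 2 * residue w 2 + residue v 3 * residue w 3)

/-- The vectors of `A₂⁴` that lie in `3 (A₂*)⁴` and whose classes form a word of the
tetracode. -/
def IsTetracode (v : A2pow4) : Prop :=
  (∀ i, 3 ∣ (v i).1 0 - (v i).1 1) ∧ residue v 0 + residue v 1 + residue v 2 = 0 ∧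
    residue v 1 - residue v 2 + residue v 3 = 0

/-- Changing the signs of the summands of `A₂⁴`. -/
def signMap (ε : Fin 4 → ℤˣ) : A2pow4 →ₗ[ℤ] A2pow4 :=
  LinearMap.pi fun i => (ε i : ℤ) • LinearMap.proj i

theorem signMap_apply (ε : Fin 4 → ℤˣ) (v : A2pow4) (i : Fin 4) :
    signMap ε v i = (ε i : ℤ) • v i := rfl

theorem signMap_signMap (ε : Fin 4 → ℤˣ) (v : A2pow4) : signMap ε (signMap ε v) = v := by
  funext i
  rw [signMap_apply, signMap_apply, smul_smul, ← Units.val_mul, Int.units_mul_self, Units.val_one,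
    one_smul]

theorem residue_signMap (ε : Fin 4 → ℤˣ) (v : A2pow4) (i : Fin 4) :
    residue (signMap ε v) i = ((ε i : ℤ) : ZMod 3) * residue v i := by
  simp [residue, signMap_apply]

theorem isIsometricEmbedding_comp {f : A2pow4 →ₗ[ℤ] A2pow4}
    (hφ : IsIsometricEmbedding (formPow (formA 2) 4) formE8 φ)
    (hf : ∀ i u v, formA 2 (f u i) (f v i) = formA 2 (u i) (v i)) :
    IsIsometricEmbedding (formPow (formA 2) 4) formE8 (φ.comp f) :=
  isIsometricEmbedding_of_map_form fun u v => by
    rw [LinearMap.comp_apply, LinearMap.comp_apply, hφ.map_form, formPow_apply, formPow_apply]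
    exact Finset.sum_congr rfl fun i _ => hf i u v

theorem formA_signMap (ε : Fin 4 → ℤˣ) (i : Fin 4) (u v : A2pow4) :
    formA 2 (signMap ε u i) (signMap ε v i) = formA 2 (u i) (v i) := by
  rw [signMap_apply, signMap_apply, map_smul, map_smul, LinearMap.smul_apply, smul_smul,
    ← Units.val_mul, Int.units_mul_self, Units.val_one, one_smul]

theorem units_cast_mul_self (e : ℤˣ) : ((e : ℤ) : ZMod 3) * ((e : ℤ) : ZMod 3) = 1 := by
  rw [← Int.cast_mul, ← Units.val_mul, Int.units_mul_self]; simp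

theorem exists_unit_cast : ∀ a : ZMod 3, a ≠ 0 → ∃ e : ℤˣ, a = ((e : ℤ) : ZMod 3) := by
  intro a ha
  have : a = 1 ∨ a = -1 := by revert a; decide
  rcases this with rfl | rfl
  · exact ⟨1, by simp⟩
  · exact ⟨-1, by simp⟩

theorem ne_zero_of_sum_sq : ∀ a b c : ZMod 3, a ≠ 0 → a * a + b * b + c * c = 0 →
    b ≠ 0 ∧ c ≠ 0 := by
  decide

/-- Up to signs, a self-orthogonal ternary code of length four is generated by two standard
words. -/
theorem exists_sign_normal_form {a₀ a₁ a₂ b₁ b₂ b₃ : ZMod 3} (ha : a₀ ≠ 0) (hb : b₃ ≠ 0)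
    (haa : a₀ * a₀ + a₁ * a₁ + a₂ * a₂ = 0) (hbb : b₁ * b₁ + b₂ * b₂ + b₃ * b₃ = 0)
    (hab : a₁ * b₁ + a₂ * b₂ = 0) :
    ∃ e₀ e₁ e₂ e₃ s : ℤˣ, a₀ = ((e₀ : ℤ) : ZMod 3) ∧ a₁ = ((e₁ : ℤ) : ZMod 3) ∧
      a₂ = ((e₂ : ℤ) : ZMod 3) ∧ b₁ = ((s : ℤ) : ZMod 3) * ((e₁ : ℤ) : ZMod 3) ∧
      b₂ = -((s : ℤ) : ZMod 3) * ((e₂ : ℤ) : ZMod 3) ∧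
      b₃ = ((s : ℤ) : ZMod 3) * ((e₃ : ℤ) : ZMod 3) := by
  obtain ⟨h1, h2⟩ := ne_zero_of_sum_sq _ _ _ ha haa
  have hb1 : b₁ ≠ 0 := (ne_zero_of_sum_sq b₃ b₁ b₂ hb (by linear_combination hbb)).1
  obtain ⟨e₀, rfl⟩ := exists_unit_cast a₀ ha
  obtain ⟨e₁, rfl⟩ := exists_unit_cast a₁ h1
  obtain ⟨e₂, rfl⟩ := exists_unit_cast a₂ h2
  obtain ⟨f₁, rfl⟩ := exists_unit_cast b₁ hb1
  obtain ⟨f₃, rfl⟩ := exists_unit_cast b₃ hb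
  have u1 := units_cast_mul_self e₁
  have u2 := units_cast_mul_self e₂
  have v1 := units_cast_mul_self f₁
  -- The signs of the first word are $e_0,e_1,e_2$. Then $s$ compares the words in position $1$,
  -- orthogonality forces the opposite comparison in position $2$, and $e_3$ absorbs the last sign.
  refine ⟨e₀, e₁, e₂, f₁ * e₁ * f₃, f₁ * e₁, rfl, rfl, rfl, ?_, ?_, ?_⟩
  · push_cast
    linear_combination -((f₁ : ℤ) : ZMod 3) * u1
  · push_cast
    linear_combination ((e₂ : ℤ) : ZMod 3) * hab - b₂ * u2
  · push_cast
    linear_combination -((f₃ : ℤ) : ZMod 3) * (((e₁ : ℤ) : ZMod 3) * ((e₁ : ℤ) : ZMod 3) * v1 + u1)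

theorem exists_eq_three_smul {u : A2pow4} (h0 : ∀ i, residue u i = 0)
    (h1 : ∀ i, 3 ∣ (u i).1 0 - (u i).1 1) : ∃ w, u = (3 : ℤ) • w := by
  simp only [residue_eq_zero_iff] at h0
  choose k hk using h0
  choose l hl using h1
  refine ⟨fun i => mkA (k i) (k i - l i), funext fun i => latticeA_two_ext ?_ ?_⟩
  · simpa [mkA] using hk i
  · have : (u i).1 1 = 3 * (k i - l i) := by linarith [hk i, hl i]
    simpa [mkA] using this

/-- Up to signs, an embedding of `A₂⁴` in `E₈` is glued along the tetracode. -/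
theorem exists_signMap_isTetracode (hφ : IsIsometricEmbedding (formPow (formA 2) 4) formE8 φ) :
    ∃ ε : Fin 4 → ℤˣ, ∀ v, (∃ x, φ (signMap ε v) = (3 : ℤ) • x) ↔ IsTetracode v := by
  obtain ⟨a, x, ha, ha0, ha3⟩ := exists_residue_ne_zero hφ (i := 0) (j := 3) (by decide)
  obtain ⟨b, y, hb, hb3, hb0⟩ := exists_residue_ne_zero hφ (i := 3) (j := 0) (by decide)
  have haa := sum_residue_sq hφ ha
  have hbb := sum_residue_sq hφ hb
  have hab := sum_residue_mul hφ ha hb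
  simp only [Fin.sum_univ_four, ha3, hb0, mul_zero, zero_mul, add_zero, zero_add] at haa hbb hab
  obtain ⟨e₀, e₁, e₂, e₃, s, ea0, ea1, ea2, eb1, eb2, eb3⟩ :=
    exists_sign_normal_form ha0 hb3 haa hbb hab
  have u0 := units_cast_mul_self e₀
  have u1 := units_cast_mul_self e₁
  have u2 := units_cast_mul_self e₂
  have u3 := units_cast_mul_self e₃
  have us := units_cast_mul_self s
  refine ⟨![e₀, e₁, e₂, e₃], fun v => ⟨?_, ?_⟩⟩
  · rintro ⟨z, hz⟩
    -- Orthogonality to the two generating words gives the two parity checks.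
    have h1 := sum_residue_mul hφ hz ha
    have h2 := sum_residue_mul hφ hz hb
    have h3 := fun i => (dvd_of_map_eq_three_smul hφ hz i).1
    simp only [Fin.sum_univ_four, residue_signMap, ha3, hb0, ea0, ea1, ea2, eb1, eb2, eb3,
      Matrix.cons_val_zero, Matrix.cons_val_one, Matrix.cons_val] at h1 h2
    refine ⟨fun i => ?_, ?_, ?_⟩
    · have := h3 i
      rcases Int.units_eq_one_or (![e₀, e₁, e₂, e₃] i) with h | h <;>
        simp [signMap_apply, h] at this <;> omega
    · linear_combination h1 - u0 * residue v 0 - u1 * residue v 1 - u2 * residue v 2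
    · linear_combination ((s : ℤ) : ZMod 3) * h2
        - residue v 1 * (((e₁ : ℤ) : ZMod 3) * ((e₁ : ℤ) : ZMod 3) * us + u1)
        + residue v 2 * (((e₂ : ℤ) : ZMod 3) * ((e₂ : ℤ) : ZMod 3) * us + u2)
        - residue v 3 * (((e₃ : ℤ) : ZMod 3) * ((e₃ : ℤ) : ZMod 3) * us + u3)
  · rintro ⟨h1, h2, h3⟩
    have h30 : (3 : ZMod 3) = 0 := rfl
    have hres : ∀ (k l : ℤ) (i : Fin 4), residue (signMap ![e₀, e₁, e₂, e₃] v - k • a - l • b) i =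
        ((![e₀, e₁, e₂, e₃] i : ℤ) : ZMod 3) * residue v i - k * residue a i - l * residue b i :=
      fun k l i => by
        rw [← residue_signMap]; simp [residue]
    -- After the sign change the words of `a` and `b` are $(1,1,1,0)$ and $s(0,1,-1,1)$, so
    -- positions $0$ and $3$ determine the coefficients and the parity checks settle the other two.
    obtain ⟨w, hw⟩ := exists_eq_three_smul
      (u := signMap ![e₀, e₁, e₂, e₃] v - (v 0).1 0 • a - ((s : ℤ) * (v 3).1 0) • b)
      (fun i => by
        rw [hres]
        push_cast
        change _ - residue v 0 * _ - _ * residue v 3 * _ = 0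
        fin_cases i <;>
          simp only [Fin.zero_eta, Fin.mk_one, Fin.reduceFinMk, Matrix.cons_val_zero,
            Matrix.cons_val_one, Matrix.cons_val, ha3, hb0, ea0, ea1, ea2, eb1, eb2, eb3]
        · ring
        · linear_combination -((e₁ : ℤ) : ZMod 3) * residue v 3 * us
            - ((e₁ : ℤ) : ZMod 3) * (h2 + h3) + h30 * ((e₁ : ℤ) : ZMod 3) * residue v 1
        · linear_combination ((e₂ : ℤ) : ZMod 3) * residue v 3 * us
            - ((e₂ : ℤ) : ZMod 3) * (h2 - h3) + h30 * ((e₂ : ℤ) : ZMod 3) * residue v 2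
        · linear_combination -((e₃ : ℤ) : ZMod 3) * residue v 3 * us)
      (fun i => by
        obtain ⟨k, hk⟩ := h1 i
        obtain ⟨l, hl⟩ := (dvd_of_map_eq_three_smul hφ ha i).1
        obtain ⟨m, hm⟩ := (dvd_of_map_eq_three_smul hφ hb i).1
        refine ⟨(![e₀, e₁, e₂, e₃] i : ℤ) * k - (v 0).1 0 * l - (s : ℤ) * (v 3).1 0 * m, ?_⟩
        simp only [Pi.sub_apply, Pi.smul_apply, signMap_apply, Submodule.coe_sub,
          Submodule.coe_smul, smul_eq_mul]
        linear_combination (![e₀, e₁, e₂, e₃] i : ℤ) * hk - (v 0).1 0 * hl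
          - (s : ℤ) * (v 3).1 0 * hm)
    refine ⟨φ w + (v 0).1 0 • x + ((s : ℤ) * (v 3).1 0) • y, ?_⟩
    have : signMap ![e₀, e₁, e₂, e₃] v =
        (3 : ℤ) • w + (v 0).1 0 • a + ((s : ℤ) * (v 3).1 0) • b := by
      rw [← hw]; abel
    rw [this, map_add, map_add, map_smul, map_smul, map_smul, ha, hb]
    module

end Glue

/-! ### Extension of isometries from $A_2^4$ to $E_8$, and conjugacy. -/

section Extension

variable {φ ψ : A2pow4 →ₗ[ℤ] E8}

theorem eq_of_three_smul {x y : E8} (h : (3 : ℤ) • x = (3 : ℤ) • y) : x = y :=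
  smul_right_injective E8 (by norm_num : (3 : ℤ) ≠ 0) h

theorem linearMap_ext_of_embedding (hφ : IsIsometricEmbedding (formPow (formA 2) 4) formE8 φ)
    {f g : E8 →ₗ[ℤ] E8} (hfg : ∀ v, f (φ v) = g (φ v)) : f = g := by
  refine LinearMap.ext fun x => ?_
  obtain ⟨v, hv, -⟩ := exists_map_eq_three_smul hφ x
  refine eq_of_three_smul ?_
  rw [← map_smul, ← map_smul, ← hv, hfg]

/-- The map sends $x$ to $\psi(v)/3$, where $\varphi(v)=3x$. -/
theorem exists_linearMap_of_glue (hφ : IsIsometricEmbedding (formPow (formA 2) 4) formE8 φ)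
    (hS : ∀ v x, φ v = (3 : ℤ) • x → ∃ y, ψ v = (3 : ℤ) • y) :
    ∃ g : E8 →ₗ[ℤ] E8, ∀ v, g (φ v) = ψ v := by
  choose p hp _ using exists_map_eq_three_smul hφ
  choose g hg using fun x => hS (p x) x (hp x)
  have hadd : ∀ x y, g (x + y) = g x + g y := fun x y => eq_of_three_smul (by
    have : p (x + y) = p x + p y := hφ.injective (by rw [map_add, hp, hp, hp, smul_add])
    rw [← hg, this, map_add, hg, hg, smul_add])
  refine ⟨(AddMonoidHom.mk' g hadd).toIntLinearMap, fun v => eq_of_three_smul ?_⟩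
  have : p (φ v) = (3 : ℤ) • v := hφ.injective (by rw [hp, map_smul])
  change (3 : ℤ) • g (φ v) = _
  rw [← hg, this, map_smul]

/-- Embeddings of `A₂⁴` that are glued in the same way differ by an isometry of `E₈`. -/
theorem exists_isometry_of_glue (hφ : IsIsometricEmbedding (formPow (formA 2) 4) formE8 φ)
    (hψ : IsIsometricEmbedding (formPow (formA 2) 4) formE8 ψ)
    (hS : ∀ v, (∃ x, φ v = (3 : ℤ) • x) ↔ ∃ x, ψ v = (3 : ℤ) • x) :
    ∃ g : isometryGroup formE8, ∀ v, g.1 (φ v) = ψ v := by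
  obtain ⟨f, hf⟩ := exists_linearMap_of_glue hφ fun v x hx => (hS v).1 ⟨x, hx⟩
  obtain ⟨g, hg⟩ := exists_linearMap_of_glue hψ fun v x hx => (hS v).2 ⟨x, hx⟩
  have hfg : f ∘ₗ g = LinearMap.id :=
    linearMap_ext_of_embedding hψ fun v => by simp [hf, hg]
  have hgf : g ∘ₗ f = LinearMap.id :=
    linearMap_ext_of_embedding hφ fun v => by simp [hf, hg]
  refine ⟨⟨LinearEquiv.ofLinearMap f g hfg hgf, fun x y => ?_⟩, hf⟩
  change formE8 (f x) (f y) = _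
  obtain ⟨v, hv, -⟩ := exists_map_eq_three_smul hφ x
  obtain ⟨w, hw, -⟩ := exists_map_eq_three_smul hφ y
  have h1 : formE8 (f ((3 : ℤ) • x)) (f ((3 : ℤ) • y)) = formE8 ((3 : ℤ) • x) ((3 : ℤ) • y) := by
    rw [← hv, ← hw, hf, hf, hψ.map_form, hφ.map_form]
  simp only [map_smul, LinearMap.smul_apply, smul_eq_mul] at h1
  linarith

theorem latticeA_two_dvd_perm (τ : Equiv.Perm (Fin 3)) (u : latticeA 2) :
    3 ∣ u.1 (τ 0) - u.1 (τ 1) ↔ 3 ∣ u.1 0 - u.1 1 := by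
  have hne : τ 0 ≠ τ 1 := fun h => by simpa using τ.injective h
  have hs := latticeA_two_sum u
  generalize τ 0 = i at *
  generalize τ 1 = j at *
  fin_cases i <;> fin_cases j <;> simp at hne ⊢ <;> omega

theorem latticeA_two_dvd_sub (u : latticeA 2) (hu : 3 ∣ u.1 0 - u.1 1) (i : Fin 3) :
    3 ∣ u.1 i - u.1 0 := by
  have hs := latticeA_two_sum u
  fin_cases i <;> simp <;> omega

theorem permA_apply (σ : Equiv.Perm (Fin 3)) (u : latticeA 2) (i : Fin 3) :
    (permA 2 σ u).1 i = u.1 (σ⁻¹ i) := rfl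

theorem formA_permA (σ : Equiv.Perm (Fin 3)) (u v : latticeA 2) :
    formA 2 (permA 2 σ u) (permA 2 σ v) = formA 2 u v := by
  have := Equiv.sum_comp (σ⁻¹) fun i => u.1 i * v.1 i
  rw [Fin.sum_univ_three, Fin.sum_univ_three] at this
  rw [formA_two_apply, formA_two_apply, ← this]
  rfl

theorem blockPerm_apply (σ : Equiv.Perm (Fin 3)) (k : ℕ) (v : A2pow4) (i : Fin 4) :
    blockPerm σ k v i = if (i : ℕ) < k then permA 2 σ (v i) else v i := by
  rw [blockPerm, LinearMap.pi_apply]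
  split_ifs <;> rfl

theorem formA_blockPerm (σ : Equiv.Perm (Fin 3)) (k : ℕ) (i : Fin 4) (u v : A2pow4) :
    formA 2 (blockPerm σ k u i) (blockPerm σ k v i) = formA 2 (u i) (v i) := by
  rw [blockPerm_apply, blockPerm_apply]
  split_ifs
  · exact formA_permA σ _ _
  · rfl

/-- The coordinates of a vector of $3A_2^*$ are congruent modulo $3$, so permuting them preserves
the residue. -/
theorem isTetracode_blockPerm (σ : Equiv.Perm (Fin 3)) (k : ℕ) (v : A2pow4) :
    IsTetracode (blockPerm σ k v) ↔ IsTetracode v := by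
  have h1 : (∀ i, 3 ∣ (blockPerm σ k v i).1 0 - (blockPerm σ k v i).1 1) ↔
      ∀ i, 3 ∣ (v i).1 0 - (v i).1 1 := by
    refine forall_congr' fun i => ?_
    rw [blockPerm_apply]
    split_ifs
    · exact latticeA_two_dvd_perm σ⁻¹ (v i)
    · rfl
  refine and_congr_right_iff.2 ?_ |>.trans (and_congr_left_iff.2 fun _ => h1)
  intro h
  have hr : residue (blockPerm σ k v) = residue v := funext fun i => by
    rw [residue, blockPerm_apply]
    split_ifs
    · have := latticeA_two_dvd_sub (v i) (h1.1 h i) (σ⁻¹ 0)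
      have := (ZMod.intCast_zmod_eq_zero_iff_dvd _ 3).2 this
      push_cast at this
      exact sub_eq_zero.1 this
    · rfl
  rw [hr]

theorem blockPerm_signMap (σ : Equiv.Perm (Fin 3)) (k : ℕ) (ε : Fin 4 → ℤˣ) (v : A2pow4) :
    blockPerm σ k (signMap ε v) = signMap ε (blockPerm σ k v) := by
  funext i
  rw [signMap_apply, blockPerm_apply, blockPerm_apply, signMap_apply]
  split_ifs
  · rw [map_smul]
  · rfl

/-- Block permutations of an embedded `A₂⁴` extend to `E₈`. -/
theorem exists_extends (hφ : IsIsometricEmbedding (formPow (formA 2) 4) formE8 φ)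
    (σ : Equiv.Perm (Fin 3)) (k : ℕ) :
    ∃ g : isometryGroup formE8, Extends φ (blockPerm σ k) g := by
  obtain ⟨ε, hε⟩ := exists_signMap_isTetracode hφ
  have h1 := isIsometricEmbedding_comp hφ (formA_signMap ε)
  have h2 := isIsometricEmbedding_comp h1 (formA_blockPerm σ k)
  obtain ⟨g, hg⟩ := exists_isometry_of_glue h1 h2 fun v =>
    (hε v).trans ((isTetracode_blockPerm σ k v).symm.trans (hε _).symm)
  refine ⟨g, fun v => ?_⟩
  have := hg (signMap ε v)
  simpa only [LinearMap.comp_apply, blockPerm_signMap, signMap_signMap] using this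

theorem Extends.eq (hφ : IsIsometricEmbedding (formPow (formA 2) 4) formE8 φ)
    {f : A2pow4 →ₗ[ℤ] A2pow4} {g g' : isometryGroup formE8} (hg : Extends φ f g)
    (hg' : Extends φ f g') : g = g' :=
  Subtype.ext (LinearEquiv.toLinearMap_injective (linearMap_ext_of_embedding hφ fun v =>
    (hg v).trans (hg' v).symm))

/-- Extensions of block permutations along two embeddings of `A₂⁴` are conjugate. -/
theorem Extends.isConj (hφ : IsIsometricEmbedding (formPow (formA 2) 4) formE8 φ)
    (hψ : IsIsometricEmbedding (formPow (formA 2) 4) formE8 ψ) {σ : Equiv.Perm (Fin 3)} {k : ℕ}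
    {g h : isometryGroup formE8} (hg : Extends φ (blockPerm σ k) g)
    (hh : Extends ψ (blockPerm σ k) h) : IsConj h g := by
  obtain ⟨ε, hε⟩ := exists_signMap_isTetracode hφ
  obtain ⟨δ, hδ⟩ := exists_signMap_isTetracode hψ
  -- After the sign changes both embeddings are glued by the same tetracode, so an isometry `c`
  -- carries one to the other. It conjugates the extensions because signs commute with block
  -- permutations.
  obtain ⟨c, hc⟩ := exists_isometry_of_glue (isIsometricEmbedding_comp hψ (formA_signMap δ))
    (isIsometricEmbedding_comp hφ (formA_signMap ε)) fun v => (hδ v).trans (hε v).symm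
  refine isConj_iff.2 ⟨c, Extends.eq (isIsometricEmbedding_comp hφ (formA_signMap ε))
    (f := blockPerm σ k) (fun v => ?_) fun v => ?_⟩
  · have h1 : c⁻¹.1 (φ.comp (signMap ε) v) = ψ.comp (signMap δ) v := by
      rw [← hc]
      exact c.1.symm_apply_apply _
    change c.1 (h.1 (c⁻¹.1 _)) = _
    rw [h1, ← hc, LinearMap.comp_apply, hh, blockPerm_signMap, LinearMap.comp_apply]
  · rw [LinearMap.comp_apply, hg, blockPerm_signMap, LinearMap.comp_apply]

end Extension

/-! ### An explicit $A_2^4$, and frames as embeddings. -/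

/-- Pairs of roots spanning four orthogonal planes, in coordinates of simple roots. -/
def standardRoots : Fin 4 → E8 × E8 :=
  ![(![0, 0, 0, 0, 0, 0, 0, 1], ![0, 0, 0, 0, 0, 0, 1, 0]),
    (![0, 0, 0, 0, 1, 0, 0, 0], ![0, 0, 0, 1, 0, 0, 0, 0]),
    (![1, 0, 0, 0, 0, 0, 0, 0], ![1, 3, 3, 5, 4, 3, 2, 1]),
    (![1, 1, 2, 2, 1, 0, 0, 0], ![1, 1, 2, 3, 3, 3, 2, 1])]

theorem standardRoots_self : ∀ i,
    (standardRoots i).1 ⬝ᵥ CartanMatrix.E₈.mulVec (standardRoots i).1 = 2 ∧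
    (standardRoots i).2 ⬝ᵥ CartanMatrix.E₈.mulVec (standardRoots i).2 = 2 ∧
    (standardRoots i).1 ⬝ᵥ CartanMatrix.E₈.mulVec (standardRoots i).2 = -1 := by
  decide +kernel

theorem standardRoots_ne : ∀ i j, i ≠ j →
    (standardRoots i).1 ⬝ᵥ CartanMatrix.E₈.mulVec (standardRoots j).1 = 0 ∧
    (standardRoots i).1 ⬝ᵥ CartanMatrix.E₈.mulVec (standardRoots j).2 = 0 ∧
    (standardRoots i).2 ⬝ᵥ CartanMatrix.E₈.mulVec (standardRoots j).1 = 0 ∧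
    (standardRoots i).2 ⬝ᵥ CartanMatrix.E₈.mulVec (standardRoots j).2 = 0 := by
  decide +kernel

/-- `E₈` contains `A₂⁴`. -/
theorem exists_isIsometricEmbedding :
    ∃ φ : A2pow4 →ₗ[ℤ] E8, IsIsometricEmbedding (formPow (formA 2) 4) formE8 φ := by
  have h1 := standardRoots_self
  have h2 := standardRoots_ne
  simp only [← formE8_apply] at h1 h2
  refine ⟨blockMap fun i => planeMap (standardRoots i).1 (standardRoots i).2 1,
    isIsometricEmbedding_blockMap
      (fun i => formE8_planeMap (h1 i).1 (h1 i).2.1 (h1 i).2.2 (by decide)) fun i j hij u v => ?_⟩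
  obtain ⟨e1, e2, e3, e4⟩ := h2 i j hij
  simp only [planeMap_apply, map_sub, LinearMap.sub_apply, map_smul, LinearMap.smul_apply,
    smul_eq_mul, e1, e2, e3, e4]
  norm_num

theorem isThreeCycle_fin_three : ∀ σ : Equiv.Perm (Fin 3), σ.IsThreeCycle →
    σ⁻¹ 0 ≠ 0 ∧ σ⁻¹ (σ⁻¹ 0) ≠ 0 ∧ σ⁻¹ (σ⁻¹ 0) ≠ σ⁻¹ 0 := by
  unfold Equiv.Perm.IsThreeCycle
  decide +kernel

variable {h : E8 ≃ₗ[ℤ] E8}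

/-- The index `σ⁻¹ 0` selects the orientation of the plane for which the rotation `h` corresponds to
`σ` rather than to its inverse. -/
theorem map_planeMap {σ : Equiv.Perm (Fin 3)} (hσ : σ.IsThreeCycle) {b : E8}
    (hb : h (h b) = -b - h b) (u : latticeA 2) :
    h (planeMap b (h b) (σ⁻¹ 0) u) = planeMap b (h b) (σ⁻¹ 0) (permA 2 σ u) := by
  obtain ⟨h1, h2, h3⟩ := isThreeCycle_fin_three σ hσ
  have hs := latticeA_two_sum u
  have hsum : u.1 (σ⁻¹ (σ⁻¹ 0)) = -u.1 0 - u.1 (σ⁻¹ 0) := by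
    generalize σ⁻¹ (σ⁻¹ 0) = k at *
    generalize σ⁻¹ 0 = j at *
    fin_cases j <;> fin_cases k <;> simp at h1 h2 h3 ⊢ <;> omega
  rw [planeMap_apply, planeMap_apply, permA_apply, permA_apply, hsum, map_sub, map_smul, map_smul,
    hb]
  module

theorem IsFrame.extends_four {β : Fin 4 → E8} {g : isometryGroup formE8} (hβ : IsFrame g.1 β)
    {σ : Equiv.Perm (Fin 3)} (hσ : σ.IsThreeCycle) :
    Extends (blockMap fun i => planeMap (β i) (g.1 (β i)) (σ⁻¹ 0)) (blockPerm σ 4) g := by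
  intro v
  rw [blockMap_apply, blockMap_apply, map_sum]
  refine Finset.sum_congr rfl fun i _ => ?_
  rw [map_planeMap hσ (hβ.map_map i), blockPerm_apply, if_pos i.2]

/-- The embedding of `A₂⁴` given by a frame of three planes and the fixed lattice. -/
theorem IsFrame.exists_extends_three {β : Fin 3 → E8} {g : isometryGroup formE8}
    (hβ : IsFrame g.1 β) {σ : Equiv.Perm (Fin 3)} (hσ : σ.IsThreeCycle)
    (hF : Isometric (formE8.restrict (fixedLattice g.1)) (formA 2)) :
    ∃ ψ : A2pow4 →ₗ[ℤ] E8, IsIsometricEmbedding (formPow (formA 2) 4) formE8 ψ ∧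
      Extends ψ (blockPerm σ 3) g := by
  obtain ⟨e, he⟩ := hF
  have ht := (isThreeCycle_fin_three σ hσ).1
  set f : latticeA 2 →ₗ[ℤ] E8 := (fixedLattice g.1).subtype ∘ₗ e.symm.toLinearMap with hf
  have hfix : ∀ u, g.1 (f u) = f u := fun u => mem_fixedLattice.1 (e.symm u).2
  have hff : ∀ u v, formE8 (f u) (f v) = formA 2 u v := fun u v => by
    rw [← e.apply_symm_apply u, ← e.apply_symm_apply v, he]
    simp [hf]
  have ho : ∀ (i : Fin 3) (u v : latticeA 2),
      formE8 (f u) (planeMap (β i) (g.1 (β i)) (σ⁻¹ 0) v) = 0 := fun i u v => by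
    have := hβ.formE8_fixed g.2 (hfix u) i
    exact formE8_planeMap_eq_zero this.1 this.2 _ _
  refine ⟨blockMap (Fin.snoc (α := fun _ => latticeA 2 →ₗ[ℤ] E8)
    (fun i => planeMap (β i) (g.1 (β i)) (σ⁻¹ 0)) f),
    isIsometricEmbedding_blockMap (fun i => ?_) fun i j => ?_, fun v => ?_⟩
  · refine Fin.lastCases ?_ (fun i => ?_) i
    · simpa only [Fin.snoc_last] using hff
    · simpa only [Fin.snoc_castSucc] using hβ.formE8_planeMap_self g.2 ht i
  · refine Fin.lastCases (Fin.lastCases (fun h => (h rfl).elim) (fun j _ u v => ?_) j)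
      (fun i => Fin.lastCases (fun _ u v => ?_) (fun j hij u v => ?_) j) i
    · simpa only [Fin.snoc_last, Fin.snoc_castSucc] using ho j u v
    · simpa only [Fin.snoc_last, Fin.snoc_castSucc, formE8_comm (planeMap (β i) _ _ _)] using
        ho i v u
    · simpa only [Fin.snoc_castSucc] using
        hβ.formE8_planeMap_planeMap g.2 (fun h => hij (by rw [h])) u v
  · rw [blockMap_apply, blockMap_apply, map_sum]
    refine Finset.sum_congr rfl fun i _ => ?_
    refine Fin.lastCases ?_ (fun i => ?_) i
    · simp only [Fin.snoc_last, blockPerm_apply]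
      rw [if_neg (by simp)]
      exact hfix _
    · simp only [Fin.snoc_castSucc, blockPerm_apply]
      rw [map_planeMap hσ (hβ.map_map i), if_pos (show (i.castSucc : ℕ) < 3 from i.2)]

theorem IsFrame.eq_one {β : Fin 0 → E8} (hβ : IsFrame h β) : h = 1 :=
  LinearEquiv.ext fun x => hβ.fixed x fun i => i.elim0

theorem not_isometric_of_eq_bot (hF : fixedLattice h = ⊥) :
    ¬ Isometric (formE8.restrict (fixedLattice h)) (formA 2) := by
  rintro ⟨e, -⟩
  have h1 : e.symm (mkA 1 0) = 0 :=
    Subtype.ext ((Submodule.eq_bot_iff _).1 hF _ (e.symm (mkA 1 0)).2)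
  have h2 : mkA 1 0 = 0 := by simpa using h1
  have h3 := congrArg (fun u : latticeA 2 => u.1 0) h2
  simp [mkA] at h3

end RootlessE8

open RootlessE8

theorem theorem4p4 (h : RootlessE8.isometryGroup RootlessE8.formE8) (h_order : orderOf h = 3) :
    (RootlessE8.IsRootless RootlessE8.formE8 h.1 ↔
      (RootlessE8.fixedLattice h.1 = ⊥ ∨
        RootlessE8.Isometric (RootlessE8.formE8.restrict (RootlessE8.fixedLattice h.1))
          (RootlessE8.formA 2))) ∧
    (∃ φ : RootlessE8.A2pow4 →ₗ[ℤ] RootlessE8.E8,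
      RootlessE8.IsIsometricEmbedding
        (RootlessE8.formPow (RootlessE8.formA 2) 4) RootlessE8.formE8 φ) ∧
    ∀ φ : RootlessE8.A2pow4 →ₗ[ℤ] RootlessE8.E8,
      RootlessE8.IsIsometricEmbedding
        (RootlessE8.formPow (RootlessE8.formA 2) 4) RootlessE8.formE8 φ →
      ∀ σ : Equiv.Perm (Fin 3), σ.IsThreeCycle →
        ∃ g₄ g₃ : RootlessE8.isometryGroup RootlessE8.formE8,
          (∀ g, RootlessE8.Extends φ (RootlessE8.blockPerm σ 4) g ↔ g = g₄) ∧
          (∀ g, RootlessE8.Extends φ (RootlessE8.blockPerm σ 3) g ↔ g = g₃) ∧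
          (RootlessE8.fixedLattice h.1 = ⊥ → IsConj h g₄) ∧
          (RootlessE8.Isometric (RootlessE8.formE8.restrict (RootlessE8.fixedLattice h.1))
              (RootlessE8.formA 2) → IsConj h g₃) := by
  have h3 : ∀ x, h.1 (h.1 (h.1 x)) = x := fun x => by
    have : h ^ 3 = 1 := by rw [← h_order, pow_orderOf_eq_one]
    exact LinearEquiv.congr_fun (congrArg Subtype.val this) x
  have hne : h.1 ≠ 1 := fun h1 => by
    have : h = 1 := Subtype.ext h1
    rw [this, orderOf_one] at h_order
    omega
  obtain ⟨n, β, hβ⟩ := exists_isFrame h.2 h3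
  have hn0 : n ≠ 0 := by
    rintro rfl
    exact hne hβ.eq_one
  have hn4 := hβ.le_four h.2
  have hthree : IsRootless formE8 h.1 → fixedLattice h.1 ≠ ⊥ → n = 3 := fun hr hF => by
    have h12 := hβ.ne_one_ne_two h.2 hr
    have : n ≠ 4 := by
      rintro rfl
      exact hF (hβ.fixedLattice_eq_bot h.2)
    omega
  refine ⟨⟨fun hr => ?_, ?_⟩, exists_isIsometricEmbedding, fun φ hφ σ hσ => ?_⟩
  · by_cases hF : fixedLattice h.1 = ⊥
    · exact Or.inl hF
    · obtain rfl := hthree hr hF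
      exact Or.inr (isometric_fixedLattice hβ h.2 h3 hr)
  · rintro (hF | hF)
    · exact isRootless_of_fixedLattice_eq_bot h.2 h3 hF
    · exact isRootless_of_isometric h.2 h3 hF
  · obtain ⟨g₄, hg₄⟩ := exists_extends hφ σ 4
    obtain ⟨g₃, hg₃⟩ := exists_extends hφ σ 3
    refine ⟨g₄, g₃, fun g => ⟨fun hg => hg.eq hφ hg₄, fun hg => hg ▸ hg₄⟩,
      fun g => ⟨fun hg => hg.eq hφ hg₃, fun hg => hg ▸ hg₃⟩, fun hF => ?_, fun hF => ?_⟩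
    · obtain rfl : n = 4 := by
        by_contra hn
        exact hβ.fixedLattice_ne_bot (by omega) hF
      exact hg₄.isConj hφ (hβ.isIsometricEmbedding h.2 (isThreeCycle_fin_three σ hσ).1)
        (hβ.extends_four hσ)
    · obtain rfl := hthree (isRootless_of_isometric h.2 h3 hF)
        fun hF0 => not_isometric_of_eq_bot hF0 hF
      obtain ⟨ψ, hψ, hψh⟩ := hβ.exists_extends_three hσ hF
      exact hg₃.isConj hφ hψ hψh
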